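/- **Setting.** Let $A$ be a finite or countably infinite alphabet, $\mathcal W$ the set of words over $A$ (including the empty word $\emptyset$), $d\ge 0$, and $\nu_{j,\ell}\in\mathbb C$ ($1\le j\le d$, $\ell\in A$). For $v\in\mathbb C^d$ and $w=\ell_1\cdots\ell_n\in\mathcal W$ put $\nu^v_w=\sum_{j=1}^d v_j(\nu_{j,\ell_1}+\cdots+\nu_{j,\ell_n})$. On $\mathbb C^{\mathcal W}$ let $(\delta\star\delta')_{\ell_1\cdots\ell_n}=\sum_{j=0}^n\delta_{\ell_1\cdots\ell_j}\delta'_{\ell_{j+1}\cdots\ell_n}$, with unit $1\!\!1$ ($1\!\!1_\emptyset=1$, $1\!\!1_w=0$ for $w\ne\emptyset$), and $(\Xi_v\delta)_w=\exp(\nu^v_w)\,\delta_w$. Let $\mathcal G$ be the group (for $\star$) of all $\gamma\in\mathbb C^{\mathcal W}$ with $\gamma_\emptyset=1$ that satisfy the shuffle relations: $\gamma_w\gamma_{w'}=\sum_j\gamma_{w_j}$ whenever the shuffle product of $w$ and $w'$ is $\sum_j w_j$. Let $\overline{\mathcal G}=\mathbb C^d\times\mathcal G$ with the product $(u,\gamma)\bigstar(v,\delta)=(v+\delta_\emptyset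 u,\ \gamma\star\Xi_u\delta)$. Let $g_1,\dots,g_d$ be linearly independent commuting smooth (that is, holomorphic) vector fields on $\mathbb C^D$ and $f_\ell$, $\ell\in A$, smooth vector fields on $\mathbb C^D$ with $[g_j,f_\ell]=\nu_{j,\ell}f_\ell$ for all $j,\ell$, where $[g,f]=f'g-g'f$. Assume that for each $v\in\mathbb C^d$ the flow of $g^v=\sum_j v_jg_j$ is defined for all real times on all of $\mathbb C^D$ by smooth maps, and let $\varphi_v$ be its time-$1$ map. Put $f_\emptyset(x)=x$ and $f_{\ell_1\cdots\ell_n}(x)=f_{\ell_2\cdots\ell_n}'(x)f_{\ell_1}(x)$. The word series $W_\delta(x)=\sum_{w\in\mathcal W}\delta_wf_w(x)$ and the extended word series $\overline W_{(v,\delta)}(x)=\varphi_v(W_\delta(x))$ are formal series: $f_\ell$ is understood as $\varepsilon_\ell f_\ell$ with commuting formal parameters $\varepsilon_\ell$, $\ell\in A$, series are power series in these parameters whose coefficients are maps $\mathbb C^D\to\mathbb C^D$, and they are composed by substitution in Taylor expansions. **Theorem.** Given $(v,\eta)\in\overline{\mathcal G}$, there is $\kappa\in\mathcal G$, depending only on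 $A$, $(\nu_{j,\ell})$, $v$ and $\eta$, such that the element $\widehat\eta\in\mathcal G$ given by $$(v,\widehat\eta)=(0,\kappa)\bigstar(v,\eta)\bigstar(0,\kappa)^{-1}=\bigl(v,\ \kappa\star\eta\star\Xi_v\kappa^{-1}\bigr)$$ satisfies $\Xi_v\widehat\eta=\widehat\eta$. Moreover, for all $g_j$, $f_\ell$ as above, $\overline W_{(v,\eta)}$ is conjugate through the invertible transformation $x=W_\kappa(X)$ (with inverse $W_{\kappa^{-1}}$) to $\overline W_{(v,\widehat\eta)}$, that is, $\overline W_{(v,\eta)}\circ W_\kappa=W_\kappa\circ\overline W_{(v,\widehat\eta)}$, and $$\overline W_{(v,\widehat\eta)}=\varphi_v\circ W_{\widehat\eta}=W_{\widehat\eta}\circ\varphi_v .$$ Also, $\varphi_u\circ W_{\widehat\eta}=W_{\widehat\eta}\circ\varphi_u$ for every $u\in\mathbb C^d$ such that $\exp(\nu^u_w)=1$ for all $w\in\mathcal W$ with $\exp(\nu^v_w)=1$. -/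

import Mathlib

open scoped ContDiff

noncomputable section

/-! ### Words, convolution, the shuffle group

Words over the alphabet `A` are lists; families of coefficients are functions `List A → ℂ`. -/

/-- The shuffle product of two words, as the list (with repetitions) of the words in the sum. -/
def shuffle {A : Type*} : List A → List A → List (List A)
  | [], w => [w]
  | a :: u, [] => [a :: u]
  | a :: u, b :: w =>
      (shuffle u (b :: w)).map (a :: ·) ++ (shuffle (a :: u) w).map (b :: ·)
termination_by u w => u.length + w.length

/-- The convolution product `δ ⋆ δ'`. -/
def conv {A : Type*} (δ δ' : List A → ℂ) : List A → ℂ :=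
  fun w => ∑ j ∈ Finset.range (w.length + 1), δ (w.take j) * δ' (w.drop j)

/-- The unit of the convolution product. -/
def convOne {A : Type*} : List A → ℂ
  | [] => 1
  | _ :: _ => 0

/-- The group `𝒢`: the families of coefficients that satisfy the shuffle relations. -/
def shuffleGroup (A : Type*) : Set (List A → ℂ) :=
  {γ | γ [] = 1 ∧ ∀ w w' : List A, γ w * γ w' = ((shuffle w w').map γ).sum}

/-- The exponent `ν^v_w = ∑_j v_j (ν_{j,ℓ₁} + ⋯ + ν_{j,ℓₙ})` of a word `w = ℓ₁⋯ℓₙ`. -/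
def nuWord {A : Type*} {d : ℕ} (ν : Fin d → A → ℂ) (v : Fin d → ℂ) (w : List A) : ℂ :=
  (w.map fun ℓ => ∑ j, v j * ν j ℓ).sum

/-- The diagonal operator `Ξ_v`. -/
def Xi {A : Type*} {d : ℕ} (ν : Fin d → A → ℂ) (v : Fin d → ℂ) (δ : List A → ℂ) : List A → ℂ :=
  fun w => Complex.exp (nuWord ν v w) * δ w

/-- The product `(u,γ) ★ (v,δ) = (v + δ_∅ u, γ ⋆ Ξ_u δ)`. -/
def extMul {A : Type*} {d : ℕ} (ν : Fin d → A → ℂ)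
    (p q : (Fin d → ℂ) × (List A → ℂ)) : (Fin d → ℂ) × (List A → ℂ) :=
  (q.1 + q.2 [] • p.1, conv p.2 (Xi ν p.1 q.2))

/-! ### Formal series of maps

Each letter `ℓ` carries a formal parameter `ε_ℓ` (that is, `f_ℓ` stands for `ε_ℓ f_ℓ`); the parameters
commute.  A formal series of maps is a power series in the parameters whose coefficients are maps
`E → E`; `Φ m` is the coefficient of the monomial `ε ^ m`, `m : A →₀ ℕ`.  Only finitely many words
contribute to each monomial, also over an infinite alphabet. -/

/-- Formal series `Φ(x) = ∑_m ε^m Φ_m(x)` of maps from `E` to `E`. -/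
abbrev FormalMap (A E : Type*) := (A →₀ ℕ) → E → E

namespace FormalMap

/-- A map, seen as a formal series without terms of positive degree. -/
def const {A E : Type*} [DecidableEq A] [Zero E] (h : E → E) : FormalMap A E :=
  fun m x => if m = 0 then h x else 0

/-- The coefficient of `ε^q` in `h(Ψ(x))`, where `Ψ(x) = Ψ_0(x) + ∑_{m ≠ 0} ε^m Ψ_m(x)` is
substituted in the Taylor series of `h` at `Ψ_0(x)`:
`h(Ψ(x)) = ∑_k (1/k!) h^{(k)}(Ψ_0(x)) [Ψ(x) - Ψ_0(x), …, Ψ(x) - Ψ_0(x)]`. -/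
def substCoeff {A E : Type*} [DecidableEq A] [NormedAddCommGroup E] [NormedSpace ℂ E]
    (h : E → E) (Ψ : FormalMap A E) (q : A →₀ ℕ) (x : E) : E :=
  ∑ k ∈ Finset.range (q.degree + 1), (k.factorial : ℂ)⁻¹ •
    ∑ r ∈ (Finset.piAntidiag (Finset.univ : Finset (Fin k)) q).filter (fun r => ∀ i, r i ≠ 0),
      iteratedFDeriv ℂ k h (Ψ 0 x) (fun i => Ψ (r i) x)

/-- The composition `Φ ∘ Ψ` of formal series of maps. -/
def comp {A E : Type*} [DecidableEq A] [NormedAddCommGroup E] [NormedSpace ℂ E]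
    (Φ Ψ : FormalMap A E) : FormalMap A E :=
  fun m x => ∑ p ∈ Finset.HasAntidiagonal.antidiagonal m, substCoeff (Φ p.1) Ψ p.2 x

end FormalMap

/-! ### Word series and extended word series -/

/-- The word basis functions: `f_∅ = id`, `f_{ℓ₁⋯ℓₙ}(x) = f'_{ℓ₂⋯ℓₙ}(x) f_{ℓ₁}(x)`; for a word
of one letter the formula gives `f_ℓ`, see `wordBasis_singleton`. -/
def wordBasis {A E : Type*} [NormedAddCommGroup E] [NormedSpace ℂ E] (f : A → E → E) :
    List A → E → E
  | [] => fun x => x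
  | ℓ :: w => fun x => fderiv ℂ (wordBasis f w) x (f ℓ x)

theorem wordBasis_singleton {A E : Type*} [NormedAddCommGroup E] [NormedSpace ℂ E]
    (f : A → E → E) (ℓ : A) : wordBasis f [ℓ] = f ℓ := by
  funext x
  simp [wordBasis]

/-- The word series `W_δ(x) = ∑_w δ_w f_w(x)`: the coefficient of `ε^m` is the sum of `δ_w f_w`
over the words `w` in which each letter `ℓ` occurs `m ℓ` times. -/
def wordSeries {A E : Type*} [DecidableEq A] [NormedAddCommGroup E] [NormedSpace ℂ E]
    (f : A → E → E) (δ : List A → ℂ) : FormalMap A E :=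
  fun m x => ∑ w ∈ (Finsupp.toMultiset m).lists.toFinset, δ w • wordBasis f w x

/-- The extended word series `W̄_{(v,δ)}(x) = φ_v(W_δ(x))`. -/
def extWordSeries {A E : Type*} [DecidableEq A] [NormedAddCommGroup E] [NormedSpace ℂ E] {d : ℕ}
    (φ : (Fin d → ℂ) → E → E) (f : A → E → E) (p : (Fin d → ℂ) × (List A → ℂ)) :
    FormalMap A E :=
  FormalMap.comp (FormalMap.const (φ p.1)) (wordSeries f p.2)

/-! ### The vector fields and their flows -/

/-- The vector field `g^v = ∑_j v_j g_j`. -/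
def linComb {E : Type*} [NormedAddCommGroup E] [NormedSpace ℂ E] {d : ℕ}
    (g : Fin d → E → E) (v : Fin d → ℂ) : E → E :=
  fun x => ∑ j, v j • g j x

/-- `g_1, …, g_d` are linearly independent commuting smooth vector fields and each smooth field
`f_ℓ` is an eigenvector of each `[g_j, ·]` with eigenvalue `ν_{j,ℓ}`.  The bracket is
`[g, f] = f' g - g' f`. -/
structure IsPerturbedSystem {A E : Type*} [NormedAddCommGroup E] [NormedSpace ℂ E] {d : ℕ}
    (ν : Fin d → A → ℂ) (g : Fin d → E → E) (f : A → E → E) : Prop where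
  smooth_g : ∀ j, ContDiff ℂ ∞ (g j)
  smooth_f : ∀ ℓ, ContDiff ℂ ∞ (f ℓ)
  linearIndependent : LinearIndependent ℂ g
  commute : ∀ j k, VectorField.lieBracket ℂ (g j) (g k) = 0
  eigen : ∀ j ℓ, VectorField.lieBracket ℂ (g j) (f ℓ) = ν j ℓ • f ℓ

/-- `φ_v` is the (smooth) flow at time `1` of `g^v`, for every `v`: the flow of `g^v` at time `t`
is `φ_{tv}`. -/
structure IsFlowFamily {E : Type*} [NormedAddCommGroup E] [NormedSpace ℂ E] {d : ℕ}
    (g : Fin d → E → E) (φ : (Fin d → ℂ) → E → E) : Prop where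
  smooth : ∀ v, ContDiff ℂ ∞ (φ v)
  map_zero : ∀ x, φ 0 x = x
  integralCurve : ∀ v x, IsIntegralCurve (fun t : ℝ => φ ((t : ℂ) • v) x) (fun _ => linComb g v)

end

/-! The equation `ηhat ⋆ Ξ_v κ = κ ⋆ η` is solved by recursion on the length of words. At a word
`w` with `exp ν^v_w ≠ 1` put `ηhat w = 0` and solve for `κ w`; at the other words the equation
determines `ηhat w`, and `κ w` is fixed by requiring the logarithmic derivative `b` of `κ` along
dilations (`|w| κ_w = (κ ⋆ b)_w`) to vanish there. Both choices are compatible with shuffles,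
because `ν^v` is constant on the words of a shuffle product; comparing the failures of the shuffle
relations in the two equations, an induction on length shows that `κ` and `ηhat` satisfy them.

For the series, let `E_w` be the differential operator with `E_w id = f_w`. By the Leibniz rule,
`E_w` of a product is a sum over the unshuffles of `w`, so for `γ` in the shuffle group the
operator `∑_w γ_w E_w` is multiplicative, and Taylor's formula turns it into composition with
`W_γ`. Hence composition of series becomes `⋆`. The bracket relation and the variational equation
give `f_ℓ ∘ φ_v = exp(ν^v_ℓ) φ_v' f_ℓ`, so moving `φ_v` through a word series applies `Ξ_v`. -/

noncomputable section

section Words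

variable {A : Type*}

/-- The linear extension of `α`, evaluated at the shuffle product of `u` and `w`. -/
def shuffleSum (α : List A → ℂ) (u w : List A) : ℂ := ((shuffle u w).map α).sum

@[simp] theorem shuffleSum_nil_left (α : List A → ℂ) (w : List A) : shuffleSum α [] w = α w := by
  simp [shuffleSum, shuffle]

@[simp] theorem shuffleSum_nil_right (α : List A → ℂ) (u : List A) : shuffleSum α u [] = α u := by
  cases u <;> simp [shuffleSum, shuffle]

theorem shuffleSum_cons_cons (α : List A → ℂ) (a b : A) (u w : List A) :
    shuffleSum α (a :: u) (b :: w) =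
      shuffleSum (fun s => α (a :: s)) u (b :: w) +
        shuffleSum (fun s => α (b :: s)) (a :: u) w := by
  simp [shuffleSum, shuffle, Function.comp_def]

theorem shuffleSum_add (α β : List A → ℂ) (u w : List A) :
    shuffleSum (fun s => α s + β s) u w = shuffleSum α u w + shuffleSum β u w := by
  simp [shuffleSum, List.sum_map_add]

theorem shuffleSum_mul_left (c : ℂ) (α : List A → ℂ) (u w : List A) :
    shuffleSum (fun s => c * α s) u w = c * shuffleSum α u w := by
  simp [shuffleSum, List.sum_map_mul_left]

theorem perm_append_of_mem_shuffle {u w s : List A} (h : s ∈ shuffle u w) : s.Perm (u ++ w) := by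
  induction u generalizing w s with
  | nil => simp_all [shuffle]
  | cons a u ihu =>
    induction w generalizing s with
    | nil => simp_all [shuffle]
    | cons b w ihw =>
      simp only [shuffle, List.mem_append, List.mem_map] at h
      rcases h with ⟨t, ht, rfl⟩ | ⟨t, ht, rfl⟩
      · exact (ihu ht).cons a
      · exact ((ihw ht).cons b).trans List.perm_middle.symm

theorem shuffleSum_congr {α β : List A → ℂ} {u w : List A}
    (h : ∀ s, s.Perm (u ++ w) → α s = β s) : shuffleSum α u w = shuffleSum β u w := by
  unfold shuffleSum
  rw [List.map_congr_left fun s hs => h s (perm_append_of_mem_shuffle hs)]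

@[simp] theorem conv_nil (δ δ' : List A → ℂ) : conv δ δ' [] = δ [] * δ' [] := by
  simp [conv]

theorem conv_cons (δ δ' : List A → ℂ) (a : A) (w : List A) :
    conv δ δ' (a :: w) = δ [] * δ' (a :: w) + conv (fun s => δ (a :: s)) δ' w := by
  simp only [conv, List.length_cons]
  rw [Finset.sum_range_succ', add_comm]
  simp

theorem conv_add_left (α β δ : List A → ℂ) (w : List A) :
    conv (fun s => α s + β s) δ w = conv α δ w + conv β δ w := by
  simp [conv, add_mul, Finset.sum_add_distrib]

theorem conv_mul_left (c : ℂ) (α δ : List A → ℂ) (w : List A) :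
    conv (fun s => c * α s) δ w = c * conv α δ w := by
  simp [conv, mul_assoc, Finset.mul_sum]

theorem conv_assoc (α β δ : List A → ℂ) : conv (conv α β) δ = conv α (conv β δ) := by
  funext w
  induction w generalizing α with
  | nil => simp [mul_assoc]
  | cons a w ih =>
    simp only [conv_cons, conv_nil, conv_add_left, conv_mul_left, ih]
    ring

theorem convOne_conv (δ : List A → ℂ) : conv convOne δ = δ := by
  funext w
  cases w with
  | nil => simp [convOne]
  | cons a w =>
    rw [conv_cons]
    simp [convOne, conv]

theorem conv_convOne (δ : List A → ℂ) : conv δ convOne = δ := by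
  funext w
  induction w generalizing δ with
  | nil => simp [convOne]
  | cons a w ih => simp [conv_cons, convOne, ih]

/-- The terms of `conv δ δ' w` in which `w` is cut into two nonempty words. -/
def innerConv (δ δ' : List A → ℂ) (w : List A) : ℂ :=
  ∑ j ∈ Finset.Ioo 0 w.length, δ (w.take j) * δ' (w.drop j)

theorem conv_eq_innerConv (δ δ' : List A → ℂ) {w : List A} (hw : w ≠ []) :
    conv δ δ' w = δ [] * δ' w + innerConv δ δ' w + δ w * δ' [] := by
  have hpos : 0 < w.length := List.length_pos_iff.2 hw
  rw [conv, Finset.sum_range_succ, Finset.range_eq_Ico, ← Finset.Ioo_insert_left hpos,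
    Finset.sum_insert (by simp), innerConv]
  simp

theorem innerConv_congr {α α' β β' : List A → ℂ} {w : List A}
    (hα : ∀ s : List A, s.length < w.length → α s = α' s)
    (hβ : ∀ s : List A, s.length < w.length → β s = β' s) :
    innerConv α β w = innerConv α' β' w := by
  refine Finset.sum_congr rfl fun j hj => ?_
  rw [Finset.mem_Ioo] at hj
  rw [hα _ (by rw [List.length_take]; omega), hβ _ (by rw [List.length_drop]; omega)]

theorem exists_eq_of_length_recursion {β : Type*} [Nonempty β] (F : List A → (List A → β) → β)
    (hF : ∀ w k k', (∀ s : List A, s.length < w.length → k s = k' s) → F w k = F w k') :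
    ∃ k : List A → β, ∀ w, k w = F w k := by
  classical
  let G (w : List A) (rec : ∀ s : List A, s.length < w.length → β) : β :=
    F w fun s => if h : s.length < w.length then rec s h else Classical.arbitrary β
  refine ⟨(measure List.length).wf.fix G, fun w => ?_⟩
  rw [WellFounded.fix_eq]
  exact hF _ _ _ fun s hs => dif_pos hs

/-- The convolution on `List A × List A`: both words are cut in all possible ways. -/
def pairConv (P Q : List A → List A → ℂ) (u w : List A) : ℂ :=
  ∑ i ∈ Finset.range (u.length + 1), ∑ j ∈ Finset.range (w.length + 1),
    P (u.take i) (w.take j) * Q (u.drop i) (w.drop j)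

theorem shuffleSum_conv (α β : List A → ℂ) (u w : List A) :
    shuffleSum (conv α β) u w = pairConv (shuffleSum α) (shuffleSum β) u w := by
  unfold pairConv
  induction u generalizing α w with
  | nil => simp [conv]
  | cons a u ihu =>
    induction w generalizing α with
    | nil => simp [conv]
    | cons b w ihw =>
      rw [shuffleSum_cons_cons]
      simp only [conv_cons, shuffleSum_add, shuffleSum_mul_left, ihu, ihw]
      simp only [List.length_cons, Finset.sum_range_succ' _ (w.length + 1),
        Finset.sum_range_succ' _ (u.length + 1), List.take_succ_cons, List.drop_succ_cons,
        List.take_zero, List.drop_zero, shuffleSum_nil_left, shuffleSum_nil_right,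
        shuffleSum_cons_cons, Finset.sum_add_distrib, add_mul]
      ring

theorem pairConv_mul_mul (α α' β β' : List A → ℂ) (u w : List A) :
    pairConv (fun s t => α s * α' t) (fun s t => β s * β' t) u w =
      conv α β u * conv α' β' w := by
  simp only [pairConv, conv, Finset.sum_mul_sum]
  exact Finset.sum_congr rfl fun i _ => Finset.sum_congr rfl fun j _ => by ring

theorem pairConv_add_right (P Q R : List A → List A → ℂ) (u w : List A) :
    pairConv P (fun s t => Q s t + R s t) u w = pairConv P Q u w + pairConv P R u w := by
  simp [pairConv, mul_add, Finset.sum_add_distrib]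

theorem pairConv_sub_pairConv {P P' Q Q' : List A → List A → ℂ} {u w : List A}
    (hpos : 0 < u.length + w.length)
    (hP : ∀ s t, s.length + t.length < u.length + w.length → P s t = P' s t)
    (hQ : ∀ s t, s.length + t.length < u.length + w.length → Q s t = Q' s t) :
    pairConv P Q u w - pairConv P' Q' u w =
      P [] [] * (Q u w - Q' u w) + (P u w - P' u w) * Q [] [] := by
  simp only [pairConv, ← Finset.sum_product', ← Finset.sum_sub_distrib]
  rw [Finset.sum_eq_add_of_mem (0, 0) (u.length, w.length) (by simp) (by simp)]
  · simp [← hP [] [] (by simpa using hpos), ← hQ [] [] (by simpa using hpos), mul_sub, sub_mul]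
  · rw [Ne, Prod.mk.injEq]
    omega
  · rintro ⟨i, j⟩ hij ⟨h0, h1⟩
    simp only [Finset.mem_product, Finset.mem_range, Ne, Prod.mk.injEq] at hij h0 h1
    rw [hP, hQ, sub_self]
    all_goals simp only [List.length_take, List.length_drop]; omega

/-- The failure of the shuffle relation of `u` and `w`. -/
def shuffleDefect (γ : List A → ℂ) (u w : List A) : ℂ := shuffleSum γ u w - γ u * γ w

theorem mem_shuffleGroup_iff {γ : List A → ℂ} :
    γ ∈ shuffleGroup A ↔ γ [] = 1 ∧ ∀ u w, shuffleDefect γ u w = 0 := by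
  simp only [shuffleGroup, shuffleDefect, shuffleSum, Set.mem_ofPred_eq, sub_eq_zero, eq_comm]

theorem shuffleSum_eq_mul_of_mem {γ : List A → ℂ} (hγ : γ ∈ shuffleGroup A) (u w : List A) :
    shuffleSum γ u w = γ u * γ w :=
  (hγ.2 u w).symm

theorem shuffleDefect_nil_left {γ : List A → ℂ} (h : γ [] = 1) (w : List A) :
    shuffleDefect γ [] w = 0 := by
  simp [shuffleDefect, h]

theorem shuffleDefect_nil_right {γ : List A → ℂ} (h : γ [] = 1) (u : List A) :
    shuffleDefect γ u [] = 0 := by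
  simp [shuffleDefect, h]

theorem shuffleDefect_conv {α β : List A → ℂ} (hα : α [] = 1) (hβ : β [] = 1) {u w : List A}
    (hα' : ∀ s t, s.length + t.length < u.length + w.length → shuffleDefect α s t = 0)
    (hβ' : ∀ s t, s.length + t.length < u.length + w.length → shuffleDefect β s t = 0) :
    shuffleDefect (conv α β) u w = shuffleDefect β u w + shuffleDefect α u w := by
  rcases Nat.eq_zero_or_pos (u.length + w.length) with h0 | hpos
  · obtain ⟨rfl, rfl⟩ : u = [] ∧ w = [] := by simpa using h0
    simp [shuffleDefect, hα, hβ]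
  · rw [shuffleDefect, shuffleSum_conv, ← pairConv_mul_mul, pairConv_sub_pairConv hpos
      (fun s t h => sub_eq_zero.1 (hα' s t h)) fun s t h => sub_eq_zero.1 (hβ' s t h)]
    simp [shuffleDefect, hα, hβ]

theorem convOne_mem_shuffleGroup : (convOne : List A → ℂ) ∈ shuffleGroup A := by
  refine mem_shuffleGroup_iff.2 ⟨rfl, fun u w => ?_⟩
  rcases u with - | ⟨a, u⟩
  · exact shuffleDefect_nil_left rfl w
  rcases w with - | ⟨b, w⟩
  · exact shuffleDefect_nil_right rfl _
  · rw [shuffleDefect, shuffleSum_cons_cons]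
    simp [convOne, shuffleSum]

theorem exists_conv_eq_convOne_left {γ : List A → ℂ} (h : γ [] = 1) :
    ∃ γ' : List A → ℂ, γ' [] = 1 ∧ conv γ' γ = convOne := by
  obtain ⟨γ', hγ'⟩ := exists_eq_of_length_recursion
    (fun w k => convOne w - (if w = [] then 0 else γ w) - innerConv k γ w)
    fun w k k' hk => by rw [innerConv_congr hk fun _ _ => rfl]
  have h0 : γ' [] = 1 := by
    rw [hγ']
    simp [convOne, innerConv]
  refine ⟨γ', h0, funext fun w => ?_⟩
  rcases eq_or_ne w [] with rfl | hw
  · simp [h, h0, convOne]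
  · rw [conv_eq_innerConv _ _ hw, hγ' w, if_neg hw, h0, h]
    ring

theorem exists_conv_eq_convOne {γ : List A → ℂ} (h : γ [] = 1) :
    ∃ γ' : List A → ℂ, γ' [] = 1 ∧ conv γ γ' = convOne ∧ conv γ' γ = convOne := by
  obtain ⟨γ', h', hleft⟩ := exists_conv_eq_convOne_left h
  obtain ⟨γ'', -, hleft'⟩ := exists_conv_eq_convOne_left h'
  have : γ'' = γ := by
    rw [← conv_convOne γ'', ← hleft, ← conv_assoc, hleft', convOne_conv]
  exact ⟨γ', h', this ▸ hleft', hleft⟩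

theorem mem_shuffleGroup_of_conv_eq_convOne {γ γ' : List A → ℂ} (hγ : γ ∈ shuffleGroup A)
    (h' : γ' [] = 1) (h : conv γ γ' = convOne) : γ' ∈ shuffleGroup A := by
  rw [mem_shuffleGroup_iff] at *
  refine ⟨h', fun u w => ?_⟩
  induction hn : u.length + w.length using Nat.strong_induction_on generalizing u w with
  | _ n ih =>
    have hdefect := shuffleDefect_conv hγ.1 h' (u := u) (w := w) (fun s t _ => hγ.2 s t)
      fun s t hst => ih _ (hn ▸ hst) s t rfl
    rwa [h, (mem_shuffleGroup_iff.1 convOne_mem_shuffleGroup).2, hγ.2, add_zero,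
      eq_comm] at hdefect

theorem exists_mem_shuffleGroup_conv_eq_convOne {γ : List A → ℂ} (hγ : γ ∈ shuffleGroup A) :
    ∃ γ' ∈ shuffleGroup A, conv γ γ' = convOne ∧ conv γ' γ = convOne := by
  obtain ⟨γ', h', hright, hleft⟩ := exists_conv_eq_convOne hγ.1
  exact ⟨γ', mem_shuffleGroup_of_conv_eq_convOne hγ h' hright, hright, hleft⟩

end Words

section NormalForm

variable {A : Type*} {d : ℕ}

@[simp] theorem nuWord_nil (ν : Fin d → A → ℂ) (v : Fin d → ℂ) : nuWord ν v [] = 0 := by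
  simp [nuWord]

theorem nuWord_append (ν : Fin d → A → ℂ) (v : Fin d → ℂ) (u w : List A) :
    nuWord ν v (u ++ w) = nuWord ν v u + nuWord ν v w := by
  simp [nuWord]

theorem nuWord_perm (ν : Fin d → A → ℂ) (v : Fin d → ℂ) {u w : List A} (h : u.Perm w) :
    nuWord ν v u = nuWord ν v w :=
  (h.map _).sum_eq

@[simp] theorem Xi_nil (ν : Fin d → A → ℂ) (v : Fin d → ℂ) (δ : List A → ℂ) :
    Xi ν v δ [] = δ [] := by
  simp [Xi]

theorem Xi_zero (ν : Fin d → A → ℂ) (δ : List A → ℂ) : Xi ν 0 δ = δ := by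
  funext w
  simp [Xi, nuWord]

theorem Xi_conv (ν : Fin d → A → ℂ) (v : Fin d → ℂ) (α β : List A → ℂ) :
    Xi ν v (conv α β) = conv (Xi ν v α) (Xi ν v β) := by
  funext w
  simp only [Xi, conv, Finset.mul_sum]
  refine Finset.sum_congr rfl fun j _ => ?_
  rw [← List.take_append_drop j w, nuWord_append, Complex.exp_add, List.take_append_drop]
  ring

theorem Xi_convOne (ν : Fin d → A → ℂ) (v : Fin d → ℂ) : Xi ν v convOne = convOne := by
  funext w
  cases w <;> simp [Xi, convOne]

theorem Xi_eq_self {ν : Fin d → A → ℂ} {v : Fin d → ℂ} {δ : List A → ℂ}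
    (h : ∀ w, Complex.exp (nuWord ν v w) ≠ 1 → δ w = 0) : Xi ν v δ = δ := by
  funext w
  by_cases hw : Complex.exp (nuWord ν v w) = 1
  · simp [Xi, hw]
  · simp [Xi, h w hw]

theorem shuffleDefect_Xi (ν : Fin d → A → ℂ) (v : Fin d → ℂ) (γ : List A → ℂ) (u w : List A) :
    shuffleDefect (Xi ν v γ) u w =
      Complex.exp (nuWord ν v (u ++ w)) * shuffleDefect γ u w := by
  rw [shuffleDefect, shuffleDefect, mul_sub, ← shuffleSum_mul_left,
    shuffleSum_congr fun s hs => by rw [Xi, nuWord_perm ν v hs], nuWord_append, Complex.exp_add]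
  simp only [Xi]
  ring

/-- The defining equations of the resonant normal form `ηhat` of `(v, η)` and of the coefficients
`κ` of the normalizing transformation.  The family `b` is the logarithmic derivative of `κ` along
the dilations `ε_ℓ ↦ t ε_ℓ`; requiring it to vanish at the resonant words makes `κ` unique. -/
structure IsResonantNormalForm (ν : Fin d → A → ℂ) (v : Fin d → ℂ) (η κ b ηhat : List A → ℂ) :
    Prop where
  coeff_nil : κ [] = 1
  logDeriv_nil : b [] = 0
  normalForm_nil : ηhat [] = 1
  length_mul_coeff : ∀ w, (w.length : ℂ) * κ w = conv κ b w
  conj : conv ηhat (Xi ν v κ) = conv κ η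
  logDeriv_of_resonant : ∀ w, Complex.exp (nuWord ν v w) = 1 → b w = 0
  normalForm_of_nonresonant : ∀ w, Complex.exp (nuWord ν v w) ≠ 1 → ηhat w = 0

/-- The equations for `p = (κ w, b w, ηhat w)` in `exists_normalForm_recursion`, at a word `w` of
length `n` with `e = exp ν^v_w`; `B` and `R` collect the terms that involve shorter words only. -/
theorem exists_normalForm_coeffs (n e B R : ℂ) (hn : n ≠ 0) :
    ∃ p : ℂ × ℂ × ℂ, n * p.1 = p.2.1 + B ∧ p.2.2 + e * p.1 = R + p.1 ∧
      (e = 1 → p.2.1 = 0) ∧ (e ≠ 1 → p.2.2 = 0) := by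
  by_cases he : e = 1
  · exact ⟨(B / n, 0, R), by simp [mul_div_cancel₀ _ hn], by simp [he], by simp, by simp [he]⟩
  · have : e - 1 ≠ 0 := sub_ne_zero.2 he
    refine ⟨(R / (e - 1), n * (R / (e - 1)) - B, 0), by simp, ?_, by simp [he], by simp⟩
    field_simp
    ring

theorem exists_normalForm_recursion (ν : Fin d → A → ℂ) (v : Fin d → ℂ) (η : List A → ℂ) :
    ∃ κ b ηhat : List A → ℂ, κ [] = 1 ∧ b [] = 0 ∧ ηhat [] = 1 ∧ ∀ w ≠ [],
      w.length * κ w = b w + innerConv κ b w ∧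
      ηhat w + Xi ν v κ w = η w + innerConv κ η w - innerConv ηhat (Xi ν v κ) w + κ w ∧
      (Complex.exp (nuWord ν v w) = 1 → b w = 0) ∧
      (Complex.exp (nuWord ν v w) ≠ 1 → ηhat w = 0) := by
  choose! sol hsol using exists_normalForm_coeffs
  let B (k : List A → ℂ × ℂ × ℂ) := innerConv (fun s => (k s).1) (fun s => (k s).2.1)
  let R (k : List A → ℂ × ℂ × ℂ) (w : List A) := η w + innerConv (fun s => (k s).1) η w -
    innerConv (fun s => (k s).2.2) (Xi ν v fun s => (k s).1) w
  obtain ⟨k, hk⟩ := exists_eq_of_length_recursion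
    (fun w k => if w = [] then (1, 0, 1)
      else sol w.length (Complex.exp (nuWord ν v w)) (B k w) (R k w))
    fun w k k' h => by
      have hB : B k w = B k' w :=
        innerConv_congr (fun s hs => by rw [h s hs]) fun s hs => by rw [h s hs]
      have hR : R k w = R k' w := by
        refine congrArg₂ (· - ·) (congrArg _ ?_) ?_ <;>
          exact innerConv_congr (fun s hs => by simp [h s hs]) fun s hs => by simp [Xi, h s hs]
      rw [hB, hR]
  have hnil : k [] = (1, 0, 1) := by simp [hk []]
  refine ⟨fun w => (k w).1, fun w => (k w).2.1, fun w => (k w).2.2, by simp [hnil],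
    by simp [hnil], by simp [hnil], fun w hw => ?_⟩
  have hsol_w := hsol w.length (Complex.exp (nuWord ν v w)) (B k w) (R k w) (by simpa using hw)
  rwa [← (hk w).trans (if_neg hw)] at hsol_w

theorem exists_isResonantNormalForm (ν : Fin d → A → ℂ) (v : Fin d → ℂ) {η : List A → ℂ}
    (hη : η [] = 1) : ∃ κ b ηhat, IsResonantNormalForm ν v η κ b ηhat := by
  obtain ⟨κ, b, ηhat, hκ, hb, hηhat, h⟩ := exists_normalForm_recursion ν v η
  refine ⟨κ, b, ηhat, hκ, hb, hηhat, fun w => ?_, funext fun w => ?_, fun w hw => ?_,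
    fun w hw => ?_⟩ <;> rcases eq_or_ne w [] with rfl | hne
  · simp [hb]
  · rw [conv_eq_innerConv _ _ hne, hκ, hb, (h w hne).1]
    ring
  · simp [hκ, hηhat, hη]
  · rw [conv_eq_innerConv _ _ hne, conv_eq_innerConv _ _ hne, Xi_nil, hκ, hηhat, hη]
    linear_combination (h w hne).2.1
  · exact hb
  · exact (h w hne).2.2.1 hw
  · simp at hw
  · exact (h w hne).2.2.2 hw

/-- The failure of `b` to vanish at the shuffle products of nonempty words. -/
def primitiveDefect (b : List A → ℂ) (u w : List A) : ℂ :=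
  shuffleSum b u w - (b u * convOne w + convOne u * b w)

theorem length_mul_shuffleDefect {κ b : List A → ℂ} (hκ : κ [] = 1) (hb : b [] = 0)
    (h : ∀ w, (w.length : ℂ) * κ w = conv κ b w) {u w : List A}
    (hpos : 0 < u.length + w.length)
    (hκ' : ∀ s t, s.length + t.length < u.length + w.length → shuffleDefect κ s t = 0)
    (hb' : ∀ s t, s.length + t.length < u.length + w.length → primitiveDefect b s t = 0) :
    ((u.length + w.length : ℕ) : ℂ) * shuffleDefect κ u w = primitiveDefect b u w := by
  have hsum : ((u.length + w.length : ℕ) : ℂ) * shuffleSum κ u w =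
      pairConv (shuffleSum κ) (shuffleSum b) u w := by
    rw [← shuffleSum_conv, ← shuffleSum_mul_left]
    refine shuffleSum_congr fun s hs => ?_
    rw [← h, hs.length_eq, List.length_append]
  have hmul : ((u.length + w.length : ℕ) : ℂ) * (κ u * κ w) =
      pairConv (fun s t => κ s * κ t) (fun s t => b s * convOne t + convOne s * b t) u w := by
    rw [pairConv_add_right, pairConv_mul_mul, pairConv_mul_mul, ← h, ← h, conv_convOne]
    push_cast
    ring
  rw [shuffleDefect, mul_sub, hsum, hmul, pairConv_sub_pairConv hpos
    (fun s t hst => sub_eq_zero.1 (hκ' s t hst)) fun s t hst => sub_eq_zero.1 (hb' s t hst)]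
  simp [hκ, hb, primitiveDefect]

namespace IsResonantNormalForm

variable {ν : Fin d → A → ℂ} {v : Fin d → ℂ} {η κ b ηhat : List A → ℂ}

theorem shuffleDefect_normalForm_add (h : IsResonantNormalForm ν v η κ b ηhat)
    (hη : η ∈ shuffleGroup A) {u w : List A}
    (hκ : ∀ s t, s.length + t.length < u.length + w.length → shuffleDefect κ s t = 0)
    (hηhat : ∀ s t, s.length + t.length < u.length + w.length → shuffleDefect ηhat s t = 0) :
    Complex.exp (nuWord ν v (u ++ w)) * shuffleDefect κ u w + shuffleDefect ηhat u w =
      shuffleDefect κ u w := by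
  rw [mem_shuffleGroup_iff] at hη
  rw [← shuffleDefect_Xi, ← shuffleDefect_conv h.normalForm_nil (by simp [h.coeff_nil]) hηhat
    fun s t hst => by rw [shuffleDefect_Xi, hκ s t hst, mul_zero], h.conj,
    shuffleDefect_conv h.coeff_nil hη.1 hκ fun s t _ => hη.2 s t, hη.2, zero_add]

theorem primitiveDefect_eq_zero_of_resonant (h : IsResonantNormalForm ν v η κ b ηhat)
    {u w : List A} (hu : u ≠ []) (hw : w ≠ []) (he : Complex.exp (nuWord ν v (u ++ w)) = 1) :
    primitiveDefect b u w = 0 := by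
  obtain ⟨a, u, rfl⟩ := List.exists_cons_of_ne_nil hu
  obtain ⟨c, w, rfl⟩ := List.exists_cons_of_ne_nil hw
  have hsum : shuffleSum b (a :: u) (c :: w) = shuffleSum (fun s => 0 * b s) (a :: u) (c :: w) :=
    shuffleSum_congr fun s hs => by
      rw [h.logDeriv_of_resonant s (by rw [nuWord_perm ν v hs, he]), mul_zero]
  rw [primitiveDefect, hsum, shuffleSum_mul_left]
  simp [convOne]

theorem shuffleDefect_normalForm_of_nonresonant (h : IsResonantNormalForm ν v η κ b ηhat)
    {u w : List A} (he : Complex.exp (nuWord ν v (u ++ w)) ≠ 1) :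
    shuffleDefect ηhat u w = 0 := by
  have hsum : shuffleSum ηhat u w = shuffleSum (fun s => 0 * ηhat s) u w :=
    shuffleSum_congr fun s hs => by
      rw [h.normalForm_of_nonresonant s (by rwa [nuWord_perm ν v hs]), mul_zero]
  have hmul : ηhat u * ηhat w = 0 := by
    by_contra hne
    obtain ⟨hu, hw⟩ := mul_ne_zero_iff.1 hne
    refine he ?_
    rw [nuWord_append, Complex.exp_add, not_not.1 (mt (h.normalForm_of_nonresonant u) hu),
      not_not.1 (mt (h.normalForm_of_nonresonant w) hw), mul_one]
  rw [shuffleDefect, hsum, hmul, shuffleSum_mul_left, zero_mul, sub_zero]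

theorem defects_eq_zero (h : IsResonantNormalForm ν v η κ b ηhat) (hη : η ∈ shuffleGroup A)
    (u w : List A) :
    shuffleDefect κ u w = 0 ∧ shuffleDefect ηhat u w = 0 ∧ primitiveDefect b u w = 0 := by
  induction hn : u.length + w.length using Nat.strong_induction_on generalizing u w with
  | _ n ih =>
  subst hn
  rcases eq_or_ne u [] with rfl | hu
  · simp [shuffleDefect, primitiveDefect, h.coeff_nil, h.normalForm_nil, h.logDeriv_nil, convOne]
  rcases eq_or_ne w [] with rfl | hw
  · simp [shuffleDefect, primitiveDefect, h.coeff_nil, h.normalForm_nil, h.logDeriv_nil, convOne]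
  have hpos : 0 < u.length + w.length := Nat.add_pos_left (List.length_pos_iff.2 hu) _
  have hlength := length_mul_shuffleDefect h.coeff_nil h.logDeriv_nil h.length_mul_coeff hpos
    (fun s t hst => (ih _ hst s t rfl).1) fun s t hst => (ih _ hst s t rfl).2.2
  have hconj := h.shuffleDefect_normalForm_add hη (fun s t hst => (ih _ hst s t rfl).1)
    fun s t hst => (ih _ hst s t rfl).2.1
  by_cases he : Complex.exp (nuWord ν v (u ++ w)) = 1
  · have hb := h.primitiveDefect_eq_zero_of_resonant hu hw he
    rw [hb] at hlength
    rw [he, one_mul, add_eq_left] at hconj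
    exact ⟨(mul_eq_zero.1 hlength).resolve_left (by exact_mod_cast hpos.ne'), hconj, hb⟩
  · have hηhat := h.shuffleDefect_normalForm_of_nonresonant he
    rw [hηhat, add_zero, mul_left_eq_self₀] at hconj
    have hκ := hconj.resolve_left he
    rw [hκ, mul_zero] at hlength
    exact ⟨hκ, hηhat, hlength.symm⟩

theorem coeff_mem_shuffleGroup (h : IsResonantNormalForm ν v η κ b ηhat)
    (hη : η ∈ shuffleGroup A) : κ ∈ shuffleGroup A :=
  mem_shuffleGroup_iff.2 ⟨h.coeff_nil, fun u w => (h.defects_eq_zero hη u w).1⟩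

theorem normalForm_mem_shuffleGroup (h : IsResonantNormalForm ν v η κ b ηhat)
    (hη : η ∈ shuffleGroup A) : ηhat ∈ shuffleGroup A :=
  mem_shuffleGroup_iff.2 ⟨h.normalForm_nil, fun u w => (h.defects_eq_zero hη u w).2.1⟩

end IsResonantNormalForm

theorem exists_resonant_normalForm (ν : Fin d → A → ℂ) (v : Fin d → ℂ) {η : List A → ℂ}
    (hη : η ∈ shuffleGroup A) :
    ∃ κ ∈ shuffleGroup A, ∃ ηhat ∈ shuffleGroup A, conv ηhat (Xi ν v κ) = conv κ η ∧
      ∀ w, Complex.exp (nuWord ν v w) ≠ 1 → ηhat w = 0 := by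
  obtain ⟨κ, b, ηhat, h⟩ := exists_isResonantNormalForm ν v hη.1
  exact ⟨κ, h.coeff_mem_shuffleGroup hη, ηhat, h.normalForm_mem_shuffleGroup hη, h.conj,
    h.normalForm_of_nonresonant⟩

end NormalForm

section Unshuffle

variable {A : Type*}

/-- The transpose of `shuffle`: the list (with repetitions) of the pairs of complementary subwords
of a word. -/
def unshuffle : List A → List (List A × List A)
  | [] => [([], [])]
  | a :: w => (unshuffle w).map (Prod.map (a :: ·) id) ++ (unshuffle w).map (Prod.map id (a :: ·))

theorem shuffle_nil_right (u : List A) : shuffle u [] = [u] := by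
  cases u <;> rw [shuffle]

theorem count_shuffle [DecidableEq A] (u u' w : List A) :
    (shuffle u u').count w = (unshuffle w).count (u, u') := by
  induction w generalizing u u' with
  | nil => cases u <;> cases u' <;> simp [shuffle, unshuffle, List.count_eq_zero]
  | cons a w ih =>
    have hcons (b : A) (l : List (List A)) :
        (l.map (b :: ·)).count (a :: w) = if b = a then l.count w else 0 := by
      split_ifs with h
      · rw [h, List.count_map_of_injective l _ List.cons_injective]
      · exact List.count_eq_zero.2 (by simp [h])
    have hsingleton (b : A) (u : List A) :
        [b :: u].count (a :: w) = if b = a then [u].count w else 0 := hcons b [u]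
    have hfst (b : A) (u u' : List A) : ((unshuffle w).map (Prod.map (a :: ·) id)).count
        (b :: u, u') = if b = a then (shuffle u u').count w else 0 := by
      split_ifs with h
      · rw [ih, h, ← List.count_map_of_injective (unshuffle w) _
          (List.cons_injective.prodMap Function.injective_id)]
        rfl
      · exact List.count_eq_zero.2 (by simp [Ne.symm h])
    have hsnd (b : A) (u u' : List A) : ((unshuffle w).map (Prod.map id (a :: ·))).count
        (u, b :: u') = if b = a then (shuffle u u').count w else 0 := by
      split_ifs with h
      · rw [ih, h, ← List.count_map_of_injective (unshuffle w) _
          (Function.injective_id.prodMap List.cons_injective)]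
        rfl
      · exact List.count_eq_zero.2 (by simp [Ne.symm h])
    have hnil_fst (u : List A) :
        ((unshuffle w).map (Prod.map (a :: ·) id)).count ([], u) = 0 :=
      List.count_eq_zero.2 (by simp)
    have hnil_snd (u : List A) :
        ((unshuffle w).map (Prod.map id (a :: ·))).count (u, []) = 0 :=
      List.count_eq_zero.2 (by simp)
    cases u <;> cases u' <;>
      simp [unshuffle, shuffle, shuffle_nil_right, hcons, hsingleton, hfst, hsnd, hnil_fst,
        hnil_snd]

theorem mem_shuffle_iff_mem_unshuffle {u u' w : List A} :
    w ∈ shuffle u u' ↔ (u, u') ∈ unshuffle w := by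
  classical
  rw [← List.count_pos_iff, count_shuffle, List.count_pos_iff]

variable [DecidableEq A]

/-- The words in which each letter `ℓ` occurs `m ℓ` times. -/
def wordsOf (m : A →₀ ℕ) : Finset (List A) := (Finsupp.toMultiset m).lists.toFinset

theorem mem_wordsOf {m : A →₀ ℕ} {w : List A} :
    w ∈ wordsOf m ↔ Multiset.toFinsupp (w : Multiset A) = m := by
  rw [Multiset.toFinsupp_eq_iff]
  simp [wordsOf, eq_comm]

theorem mem_wordsOf_of_perm {m : A →₀ ℕ} {u w : List A} (h : u.Perm w) (hw : w ∈ wordsOf m) :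
    u ∈ wordsOf m := by
  rwa [mem_wordsOf, Multiset.coe_eq_coe.2 h, ← mem_wordsOf]

theorem wordsOf_zero : wordsOf (0 : A →₀ ℕ) = {[]} := by
  ext w
  simp [mem_wordsOf]

theorem length_of_mem_wordsOf {m : A →₀ ℕ} {w : List A} (h : w ∈ wordsOf m) :
    w.length = m.degree := by
  rw [mem_wordsOf, Multiset.toFinsupp_eq_iff] at h
  rw [← Multiset.coe_card, h, Finsupp.card_toMultiset]
  rfl

theorem sum_map_eq_sum_count_nsmul {ι M : Type*} [BEq ι] [LawfulBEq ι] [AddCommMonoid M]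
    {l : List ι} {s : Finset ι} (h : ∀ i ∈ l, i ∈ s) (X : ι → M) :
    (l.map X).sum = ∑ i ∈ s, l.count i • X i := by
  classical
  induction l with
  | nil => simp
  | cons i l ih =>
    simp only [List.forall_mem_cons] at h
    simp [List.count_cons, add_smul, Finset.sum_add_distrib, ih h.2, h.1, add_comm]

/-- The pairs of words in which each letter `ℓ` occurs `m ℓ` times altogether. -/
def wordPairsOf (m : A →₀ ℕ) : Finset (List A × List A) :=
  (Finset.HasAntidiagonal.antidiagonal m).biUnion fun p => wordsOf p.1 ×ˢ wordsOf p.2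

theorem mem_wordPairsOf {m : A →₀ ℕ} {p : List A × List A} :
    p ∈ wordPairsOf m ↔ p.1 ++ p.2 ∈ wordsOf m := by
  simp [wordPairsOf, mem_wordsOf, ← Multiset.coe_add]

theorem sum_wordPairsOf {M : Type*} [AddCommMonoid M] (m : A →₀ ℕ) (X : List A × List A → M) :
    ∑ p ∈ wordPairsOf m, X p = ∑ r ∈ Finset.HasAntidiagonal.antidiagonal m,
      ∑ u ∈ wordsOf r.1, ∑ u' ∈ wordsOf r.2, X (u, u') := by
  rw [wordPairsOf, Finset.sum_biUnion fun r _ s _ hrs => Finset.disjoint_left.2 fun p hr hs => ?_]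
  · simp only [Finset.sum_product]
  · simp only [Finset.mem_product, mem_wordsOf] at hr hs
    exact hrs (Prod.ext (hr.1.symm.trans hs.1) (hr.2.symm.trans hs.2))

theorem sum_smul_sum_unshuffle {M : Type*} [AddCommGroup M] [Module ℂ M] {γ : List A → ℂ}
    (hγ : γ ∈ shuffleGroup A) (m : A →₀ ℕ) (X : List A × List A → M) :
    ∑ w ∈ wordsOf m, γ w • ((unshuffle w).map X).sum =
      ∑ p ∈ wordPairsOf m, (γ p.1 * γ p.2) • X p := by
  have hunshuffle : ∀ w ∈ wordsOf m, ((unshuffle w).map X).sum =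
      ∑ p ∈ wordPairsOf m, (unshuffle w).count p • X p := fun w hw =>
    sum_map_eq_sum_count_nsmul (fun p hp => mem_wordPairsOf.2 (mem_wordsOf_of_perm
      (perm_append_of_mem_shuffle (mem_shuffle_iff_mem_unshuffle.2 hp)).symm hw)) X
  have hshuffle : ∀ p ∈ wordPairsOf m, γ p.1 * γ p.2 =
      ∑ w ∈ wordsOf m, (unshuffle w).count p • γ w := by
    intro p hp
    rw [← shuffleSum_eq_mul_of_mem hγ, shuffleSum, sum_map_eq_sum_count_nsmul fun w hw =>
      mem_wordsOf_of_perm (perm_append_of_mem_shuffle hw) (mem_wordPairsOf.1 hp)]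
    simp only [count_shuffle]
  rw [Finset.sum_congr rfl fun w hw => by rw [hunshuffle w hw, Finset.smul_sum], Finset.sum_comm]
  refine Finset.sum_congr rfl fun p hp => ?_
  rw [hshuffle p hp, Finset.sum_smul]
  refine Finset.sum_congr rfl fun w _ => ?_
  rw [smul_comm, smul_assoc]

end Unshuffle

section WordOp

variable {A E F G H : Type*} [NormedAddCommGroup E] [NormedSpace ℂ E] [NormedAddCommGroup F]
  [NormedSpace ℂ F] [NormedAddCommGroup G] [NormedSpace ℂ G] [NormedAddCommGroup H]
  [NormedSpace ℂ H] {f : A → E → E}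

/-- The differential operator `E_{ℓ₁} ⋯ E_{ℓₙ}` of a word `ℓ₁⋯ℓₙ`, where
`(E_ℓ h)(x) = h'(x) f_ℓ(x)`. -/
def wordOp (f : A → E → E) : List A → (E → F) → E → F
  | [], h => h
  | ℓ :: w, h => fun x => fderiv ℂ (wordOp f w h) x (f ℓ x)

theorem wordBasis_eq_wordOp (f : A → E → E) (w : List A) : wordBasis f w = wordOp f w id := by
  induction w with
  | nil => rfl
  | cons ℓ w ih => simp only [wordBasis, wordOp, ih]

theorem wordOp_append (f : A → E → E) (u w : List A) (h : E → F) :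
    wordOp f (u ++ w) h = wordOp f u (wordOp f w h) := by
  induction u with
  | nil => rfl
  | cons ℓ u ih => simp only [List.cons_append, wordOp, ih]

theorem wordOp_sub_const (f : A → E → E) {w : List A} (hw : w ≠ []) (h : E → F) (c : F) :
    wordOp f w (fun y => h y - c) = wordOp f w h := by
  obtain ⟨u, ℓ, rfl⟩ := w.eq_nil_or_concat.resolve_left hw
  simp only [List.concat_eq_append, wordOp_append, wordOp, fderiv_sub_const]

theorem contDiff_wordOp (hf : ∀ ℓ, ContDiff ℂ ∞ (f ℓ)) (w : List A) {h : E → F}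
    (hh : ContDiff ℂ ∞ h) : ContDiff ℂ ∞ (wordOp f w h) := by
  induction w with
  | nil => exact hh
  | cons ℓ w ih => exact (ih.fderiv_right (m := ∞) (by simp)).clm_apply (hf ℓ)

theorem differentiable_wordOp (hf : ∀ ℓ, ContDiff ℂ ∞ (f ℓ)) (w : List A) {h : E → F}
    (hh : ContDiff ℂ ∞ h) : Differentiable ℂ (wordOp f w h) :=
  (contDiff_wordOp hf w hh).differentiable (by simp)

theorem wordOp_add (hf : ∀ ℓ, ContDiff ℂ ∞ (f ℓ)) (w : List A) {h₁ h₂ : E → F}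
    (hh₁ : ContDiff ℂ ∞ h₁) (hh₂ : ContDiff ℂ ∞ h₂) (x : E) :
    wordOp f w (fun y => h₁ y + h₂ y) x = wordOp f w h₁ x + wordOp f w h₂ x := by
  induction w generalizing x with
  | nil => rfl
  | cons ℓ w ih =>
    simp only [wordOp]
    rw [funext ih, fderiv_fun_add (differentiable_wordOp hf w hh₁ x)
      (differentiable_wordOp hf w hh₂ x), add_apply]

theorem wordOp_sum (hf : ∀ ℓ, ContDiff ℂ ∞ (f ℓ)) (w : List A) {ι : Type*} (s : Finset ι)
    (c : ι → ℂ) {h : ι → E → F} (hh : ∀ i, ContDiff ℂ ∞ (h i)) (x : E) :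
    wordOp f w (fun y => ∑ i ∈ s, c i • h i y) x = ∑ i ∈ s, c i • wordOp f w (h i) x := by
  induction w generalizing x with
  | nil => rfl
  | cons ℓ w ih =>
    have hdiff i : Differentiable ℂ (wordOp f w (h i)) := differentiable_wordOp hf w (hh i)
    simp only [wordOp]
    rw [funext ih, fderiv_fun_sum fun i _ => (hdiff i x).fun_const_smul (c i), sum_apply]
    exact Finset.sum_congr rfl fun i _ => by rw [fderiv_fun_const_smul (hdiff i x), smul_apply]

theorem fderiv_sum_map_apply {ι : Type*} (l : List ι) {X : ι → E → F}
    (hX : ∀ i, Differentiable ℂ (X i)) (x v : E) :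
    fderiv ℂ (fun y => (l.map fun i => X i y).sum) x v =
      (l.map fun i => fderiv ℂ (X i) x v).sum := by
  simp only [← Fin.sum_univ_fun_getElem]
  rw [fderiv_fun_sum fun i _ => hX _ x, sum_apply]

theorem wordOp_bilinear (hf : ∀ ℓ, ContDiff ℂ ∞ (f ℓ)) (B : F →L[ℂ] G →L[ℂ] H) {a : E → F}
    {b : E → G} (ha : ContDiff ℂ ∞ a) (hb : ContDiff ℂ ∞ b) (w : List A) (x : E) :
    wordOp f w (fun y => B (a y) (b y)) x =
      ((unshuffle w).map fun p => B (wordOp f p.1 a x) (wordOp f p.2 b x)).sum := by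
  induction w generalizing x with
  | nil => simp [unshuffle, wordOp]
  | cons ℓ w ih =>
    have hderiv (p : List A × List A) (y : E) := B.hasFDerivAt_of_bilinear
      (differentiable_wordOp hf p.1 ha y).hasFDerivAt
      (differentiable_wordOp hf p.2 hb y).hasFDerivAt
    simp only [wordOp]
    rw [funext ih, fderiv_sum_map_apply _ fun p y => (hderiv p y).differentiableAt]
    simp [(hderiv _ x).fderiv, unshuffle, List.sum_map_add, wordOp, Function.comp_def, add_comm]

variable [DecidableEq A]

/-- The series `∑_w γ_w E_w h`: the coefficient of `ε^m` collects the words in which each letter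
`ℓ` occurs `m ℓ` times. For `γ` in the shuffle group it is `h ∘ W_γ`. -/
def opSeries (f : A → E → E) (γ : List A → ℂ) (h : E → F) (m : A →₀ ℕ) (x : E) : F :=
  ∑ w ∈ wordsOf m, γ w • wordOp f w h x

theorem wordSeries_eq_opSeries (f : A → E → E) (γ : List A → ℂ) :
    wordSeries f γ = opSeries f γ id := by
  funext m x
  simp only [wordSeries, opSeries, wordBasis_eq_wordOp, wordsOf]

theorem opSeries_zero (f : A → E → E) {γ : List A → ℂ} (hγ : γ [] = 1) (h : E → F) (x : E) :
    opSeries f γ h 0 x = h x := by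
  simp [opSeries, wordsOf_zero, hγ, wordOp]

theorem opSeries_sub_const (f : A → E → E) (γ : List A → ℂ) (h : E → F) (c : F) {m : A →₀ ℕ}
    (hm : m ≠ 0) (x : E) : opSeries f γ (fun y => h y - c) m x = opSeries f γ h m x := by
  refine Finset.sum_congr rfl fun w hw => ?_
  rw [wordOp_sub_const f (by rintro rfl; exact hm (by simpa [eq_comm] using mem_wordsOf.1 hw))]

theorem contDiff_opSeries (hf : ∀ ℓ, ContDiff ℂ ∞ (f ℓ)) (γ : List A → ℂ) {h : E → F}
    (hh : ContDiff ℂ ∞ h) (m : A →₀ ℕ) : ContDiff ℂ ∞ (opSeries f γ h m) :=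
  ContDiff.sum fun w _ => (contDiff_wordOp hf w hh).const_smul (γ w)

theorem opSeries_add (hf : ∀ ℓ, ContDiff ℂ ∞ (f ℓ)) (γ : List A → ℂ) {h₁ h₂ : E → F}
    (hh₁ : ContDiff ℂ ∞ h₁) (hh₂ : ContDiff ℂ ∞ h₂) (m : A →₀ ℕ) (x : E) :
    opSeries f γ (fun y => h₁ y + h₂ y) m x = opSeries f γ h₁ m x + opSeries f γ h₂ m x := by
  simp only [opSeries, wordOp_add hf _ hh₁ hh₂, smul_add, Finset.sum_add_distrib]

theorem opSeries_sum (hf : ∀ ℓ, ContDiff ℂ ∞ (f ℓ)) (γ : List A → ℂ) {ι : Type*} (s : Finset ι)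
    (c : ι → ℂ) {h : ι → E → F} (hh : ∀ i, ContDiff ℂ ∞ (h i)) (m : A →₀ ℕ) (x : E) :
    opSeries f γ (fun y => ∑ i ∈ s, c i • h i y) m x = ∑ i ∈ s, c i • opSeries f γ (h i) m x := by
  simp only [opSeries, wordOp_sum hf _ s c hh, Finset.smul_sum, smul_comm (c _)]
  exact Finset.sum_comm

theorem opSeries_const (hf : ∀ ℓ, ContDiff ℂ ∞ (f ℓ)) (γ : List A → ℂ) (c : F) {m : A →₀ ℕ}
    (hm : m ≠ 0) (x : E) : opSeries f γ (fun _ => c) m x = 0 := by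
  rw [← opSeries_sub_const f γ _ c hm]
  simpa using opSeries_sum hf γ ∅ (fun _ : Unit => 0) (fun _ => contDiff_const (c := c)) m x

theorem opSeries_bilinear (hf : ∀ ℓ, ContDiff ℂ ∞ (f ℓ)) {γ : List A → ℂ}
    (hγ : γ ∈ shuffleGroup A) (B : F →L[ℂ] G →L[ℂ] H) {a : E → F} {b : E → G}
    (ha : ContDiff ℂ ∞ a) (hb : ContDiff ℂ ∞ b) (m : A →₀ ℕ) (x : E) :
    opSeries f γ (fun y => B (a y) (b y)) m x = ∑ r ∈ Finset.HasAntidiagonal.antidiagonal m,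
      B (opSeries f γ a r.1 x) (opSeries f γ b r.2 x) := by
  simp only [opSeries, wordOp_bilinear hf B ha hb, map_sum, map_smul, sum_apply, smul_apply,
    sum_smul_sum_unshuffle hγ, sum_wordPairsOf, mul_smul, Finset.smul_sum]
  refine Finset.sum_congr rfl fun r _ => ?_
  rw [Finset.sum_comm]
  exact Finset.sum_congr rfl fun u' _ => Finset.sum_congr rfl fun u _ => smul_comm _ _ _

end WordOp

section Multilinear

universe u

variable {A : Type*} {E F : Type u} [NormedAddCommGroup E] [NormedSpace ℂ E]
  [NormedAddCommGroup F] [NormedSpace ℂ F] {f : A → E → E}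

theorem sum_piAntidiag_univ_fin_succ {M N : Type*} [AddCommMonoid M] [DecidableEq M]
    [Finset.HasAntidiagonal M] [AddCommMonoid N] (k : ℕ) (m : M) (X : (Fin (k + 1) → M) → N) :
    ∑ r ∈ Finset.piAntidiag Finset.univ m, X r = ∑ p ∈ Finset.HasAntidiagonal.antidiagonal m,
      ∑ r ∈ Finset.piAntidiag Finset.univ p.1, X (Fin.snoc r p.2) := by
  rw [Finset.sum_sigma']
  refine Finset.sum_nbij' (fun r => ⟨(∑ i, Fin.init r i, r (Fin.last k)), Fin.init r⟩)
    (fun s => Fin.snoc s.2 s.1.2) ?_ ?_ ?_ ?_ ?_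
  · intro r hr
    have hsum : ∑ i : Fin k, Fin.init r i + r (Fin.last k) = m := by
      rw [← (Finset.mem_piAntidiag.1 hr).1, Fin.sum_univ_castSucc]
      rfl
    simp [hsum]
  · rintro ⟨p, r⟩ h
    simp_all [Fin.sum_univ_castSucc]
  · simp
  · rintro ⟨p, r⟩ h
    simp_all
  · simp

theorem fderiv_iteratedFDeriv_apply {h : E → F} (hh : ContDiff ℂ ∞ h) {k : ℕ} (m : Fin k → E)
    (x e : E) : fderiv ℂ (fun z => iteratedFDeriv ℂ k h z m) x e =
      iteratedFDeriv ℂ (k + 1) h x (Fin.cons e m) := by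
  rw [fderiv_continuousMultilinear_apply_const_apply
    (hh.differentiable_iteratedFDeriv (by exact_mod_cast ENat.natCast_lt_top k) x),
    iteratedFDeriv_succ_apply_left, Fin.cons_zero, Fin.tail_cons]

theorem contDiff_iteratedFDeriv_apply {h : E → F} (hh : ContDiff ℂ ∞ h) {k : ℕ} (m : Fin k → E) :
    ContDiff ℂ ∞ fun z => iteratedFDeriv ℂ k h z m :=
  (ContinuousMultilinearMap.apply ℂ (fun _ => E) F m).contDiff.comp
    (hh.iteratedFDeriv_right (m := ∞) (by exact_mod_cast le_top))

theorem iteratedFDeriv_cons_cons_swap {h : E → F} (hh : ContDiff ℂ ∞ h) {k : ℕ} (m : Fin k → E)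
    (x a b : E) : iteratedFDeriv ℂ (k + 2) h x (Fin.cons a (Fin.cons b m)) =
      iteratedFDeriv ℂ (k + 2) h x (Fin.cons b (Fin.cons a m)) := by
  set D : E → F := fun z => iteratedFDeriv ℂ k h z m
  have hD : ContDiff ℂ ∞ D := contDiff_iteratedFDeriv_apply hh m
  have hcons (a b : E) : iteratedFDeriv ℂ (k + 2) h x (Fin.cons a (Fin.cons b m)) =
      fderiv ℂ (fderiv ℂ D) x a b := by
    rw [← fderiv_iteratedFDeriv_apply hh, ← funext fun z => fderiv_iteratedFDeriv_apply hh m z b,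
      fderiv_clm_apply ((hD.fderiv_right (m := ∞) (by simp)).differentiable (by simp) x)
      (by simp)]
    simp
  rw [hcons, hcons]
  exact hD.contDiffAt.isSymmSndFDerivAt (by simpa using ENat.LEInfty.out) a b

theorem iteratedFDeriv_succ_insertNth {h : E → F} (hh : ContDiff ℂ ∞ h) {k : ℕ} (i : Fin (k + 1))
    (e : E) (m : Fin k → E) (x : E) :
    iteratedFDeriv ℂ (k + 1) h x (i.insertNth e m) = iteratedFDeriv ℂ k (fderiv ℂ h) x m e := by
  induction k generalizing x with
  | zero => simp [iteratedFDeriv_succ_apply_right, Fin.fin_one_eq_zero i]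
  | succ k ih =>
    have hcons (i : Fin (k + 1)) : iteratedFDeriv ℂ (k + 2) h x
        (Fin.cons (m 0) (i.insertNth e (Fin.tail m))) =
          iteratedFDeriv ℂ (k + 1) (fderiv ℂ h) x m e := by
      have hh' : ContDiff ℂ ∞ (fderiv ℂ h) := hh.fderiv_right (by simp)
      have hD : ContDiff ℂ ∞ fun z => iteratedFDeriv ℂ k (fderiv ℂ h) z (Fin.tail m) :=
        contDiff_iteratedFDeriv_apply hh' _
      rw [← fderiv_iteratedFDeriv_apply hh, funext fun z => ih i (Fin.tail m) z,
        fderiv_clm_apply (hD.differentiable (by simp) x) (by simp)]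
      simp [fderiv_iteratedFDeriv_apply hh']
    refine Fin.cases ?_ (fun j => ?_) i
    · rw [← hcons 0, Fin.insertNth_zero', Fin.insertNth_zero', iteratedFDeriv_cons_cons_swap hh,
        Fin.cons_self_tail]
    · rw [← hcons j, ← Fin.insertNth_succ_cons, Fin.cons_self_tail]

/-- The remainder of the Taylor expansion of `h` at `p` to order `n`. -/
def taylorRemainder (h : E → F) (p : E) (n : ℕ) (y : E) : F :=
  h y - ∑ k ∈ Finset.range (n + 1),
    (k.factorial : ℂ)⁻¹ • iteratedFDeriv ℂ k h p fun _ => y - p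

theorem taylorRemainder_self (h : E → F) (p : E) (n : ℕ) : taylorRemainder h p n p = 0 := by
  rw [taylorRemainder, Finset.sum_range_succ', Finset.sum_eq_zero fun k _ => ?_]
  · simp
  · simp only [sub_self]
    rw [ContinuousMultilinearMap.map_coord_zero _ 0 rfl, smul_zero]

theorem contDiff_taylorRemainder {h : E → F} (hh : ContDiff ℂ ∞ h) (p : E) (n : ℕ) :
    ContDiff ℂ ∞ (taylorRemainder h p n) :=
  hh.sub <| ContDiff.sum fun k _ => ((iteratedFDeriv ℂ k h p).contDiff.comp
    (contDiff_pi.2 fun _ => contDiff_id.sub contDiff_const)).const_smul _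

theorem hasFDerivAt_iteratedFDeriv_const_sub {h : E → F} (hh : ContDiff ℂ ∞ h) (p : E)
    (k : ℕ) (y : E) : HasFDerivAt (fun y => iteratedFDeriv ℂ (k + 1) h p fun _ => y - p)
      (((k + 1 : ℕ) : ℂ) • iteratedFDeriv ℂ k (fderiv ℂ h) p fun _ => y - p) y := by
  have hsub : HasFDerivAt (fun y : E => fun _ : Fin (k + 1) => y - p)
      (ContinuousLinearMap.pi fun _ => ContinuousLinearMap.id ℂ E) y :=
    hasFDerivAt_pi.2 fun _ => (hasFDerivAt_id y).sub_const p
  have hupdate (i : Fin (k + 1)) (e : E) :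
      Function.update (fun _ => y - p) i e = i.insertNth e fun _ => y - p := by
    funext j
    refine Fin.succAboveCases i ?_ (fun j => ?_) j <;> simp
  refine (((iteratedFDeriv ℂ (k + 1) h p).hasFDerivAt _).comp y hsub).congr_fderiv ?_
  ext1 e
  simp [hupdate, iteratedFDeriv_succ_insertNth hh, ← Nat.cast_smul_eq_nsmul ℂ]

theorem hasFDerivAt_taylorRemainder_succ {h : E → F} (hh : ContDiff ℂ ∞ h) (p : E) (n : ℕ)
    (y : E) :
    HasFDerivAt (taylorRemainder h p (n + 1)) (taylorRemainder (fderiv ℂ h) p n y) y := by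
  have hterm (k : ℕ) := (hasFDerivAt_iteratedFDeriv_const_sub hh p k y).const_smul
    (((k + 1).factorial : ℂ)⁻¹)
  have hsum := HasFDerivAt.fun_sum fun k (_ : k ∈ Finset.range (n + 1)) => hterm k
  have hcoeff (k : ℕ) : ((k + 1).factorial : ℂ)⁻¹ * ((k + 1 : ℕ) : ℂ) = (k.factorial : ℂ)⁻¹ := by
    rw [Nat.factorial_succ, Nat.cast_mul, mul_inv, mul_right_comm,
      inv_mul_cancel₀ (Nat.cast_ne_zero.2 k.succ_ne_zero), one_mul]
  simp only [smul_smul, hcoeff] at hsum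
  unfold taylorRemainder
  simp only [Finset.sum_range_succ' _ (n + 1), iteratedFDeriv_zero_apply]
  exact (hh.differentiable (by simp) y).hasFDerivAt.sub (hsum.add_const _)

theorem wordOp_taylorRemainder_comp (hf : ∀ ℓ, ContDiff ℂ ∞ (f ℓ)) {h : E → F}
    (hh : ContDiff ℂ ∞ h) {φ : E → E} (hφ : ContDiff ℂ ∞ φ) {w : List A} {n : ℕ}
    (hw : w.length ≤ n) (x : E) :
    wordOp f w (fun y => taylorRemainder h (φ x) n (φ y)) x = 0 := by
  induction n generalizing F w with
  | zero =>
    rw [List.length_eq_zero_iff.1 (Nat.le_zero.1 hw)]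
    exact taylorRemainder_self h (φ x) 0
  | succ n ih =>
    rcases w.eq_nil_or_concat with rfl | ⟨u, ℓ, rfl⟩
    · exact taylorRemainder_self h (φ x) (n + 1)
    have hh' : ContDiff ℂ ∞ (fderiv ℂ h) := hh.fderiv_right (by simp)
    have hlast : wordOp f [ℓ] (fun y => taylorRemainder h (φ x) (n + 1) (φ y)) =
        fun y => ContinuousLinearMap.id ℂ (E →L[ℂ] F) (taylorRemainder (fderiv ℂ h) (φ x) n (φ y))
          (wordOp f [ℓ] φ y) := by
      funext y
      simp only [wordOp]
      exact congrFun (congrArg _ ((hasFDerivAt_taylorRemainder_succ hh (φ x) n (φ y)).comp y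
        (hφ.differentiable (by simp) y).hasFDerivAt).fderiv) _
    have hR : ContDiff ℂ ∞ fun y => taylorRemainder (fderiv ℂ h) (φ x) n (φ y) :=
      (contDiff_taylorRemainder hh' (φ x) n).comp hφ
    rw [List.concat_eq_append, wordOp_append, hlast,
      wordOp_bilinear hf _ hR (contDiff_wordOp hf [ℓ] hφ)]
    refine List.sum_eq_zero fun z hz => ?_
    obtain ⟨p, hp, rfl⟩ := List.mem_map.1 hz
    have hlen : p.1.length ≤ n := by
      have := (perm_append_of_mem_shuffle (mem_shuffle_iff_mem_unshuffle.2 hp)).length_eq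
      simp only [List.length_append] at this
      simp only [List.concat_eq_append, List.length_append, List.length_singleton] at hw
      omega
    rw [ih hh' hlen]
    simp

variable [DecidableEq A]

theorem opSeries_multilinear (hf : ∀ ℓ, ContDiff ℂ ∞ (f ℓ)) {γ : List A → ℂ}
    (hγ : γ ∈ shuffleGroup A) {ψ : E → E} (hψ : ContDiff ℂ ∞ ψ) {k : ℕ} (M : E [×k]→L[ℂ] F)
    (m : A →₀ ℕ) (x : E) :
    opSeries f γ (fun y => M fun _ => ψ y) m x =
      ∑ r ∈ Finset.piAntidiag Finset.univ m, M fun i => opSeries f γ ψ (r i) x := by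
  induction k generalizing F m with
  | zero =>
    rcases eq_or_ne m 0 with rfl | hm
    · rw [opSeries_zero f hγ.1]
      rw [Finset.univ_eq_empty, Finset.piAntidiag_zero, Finset.sum_singleton]
      exact congrArg M (Subsingleton.elim _ _)
    · simp [hm, Subsingleton.elim (fun _ : Fin 0 => ψ _) ![], opSeries_const hf γ _ hm]
  | succ k ih =>
    have hcurry (y : E) : (M fun _ => ψ y) =
        ContinuousLinearMap.id ℂ (E →L[ℂ] F) (M.curryRight fun _ => ψ y) (ψ y) := by
      rw [ContinuousLinearMap.id_apply, ContinuousMultilinearMap.curryRight_apply]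
      exact congrArg M (Fin.snoc_init_self fun _ => ψ y).symm
    have hM : ContDiff ℂ ∞ fun y => M.curryRight fun _ => ψ y :=
      M.curryRight.contDiff.comp (contDiff_pi.2 fun _ => hψ)
    simp only [hcurry, opSeries_bilinear hf hγ _ hM hψ, ih, map_sum, sum_apply]
    refine Eq.trans ?_ (sum_piAntidiag_univ_fin_succ k m _).symm
    refine Finset.sum_congr rfl fun p _ => Finset.sum_congr rfl fun r _ => ?_
    rw [ContinuousLinearMap.id_apply, ContinuousMultilinearMap.curryRight_apply]
    congr 1
    funext i
    refine Fin.lastCases ?_ (fun j => ?_) i <;> simp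

theorem opSeries_taylorRemainder_comp (hf : ∀ ℓ, ContDiff ℂ ∞ (f ℓ)) (γ : List A → ℂ)
    {h : E → F} (hh : ContDiff ℂ ∞ h) {φ : E → E} (hφ : ContDiff ℂ ∞ φ) (q : A →₀ ℕ) (x : E) :
    opSeries f γ (fun y => taylorRemainder h (φ x) q.degree (φ y)) q x = 0 :=
  Finset.sum_eq_zero fun w hw => by
    rw [wordOp_taylorRemainder_comp hf hh hφ (length_of_mem_wordsOf hw).le, smul_zero]

theorem sum_filter_ne_zero_opSeries (f : A → E → E) {γ : List A → ℂ} (hγ : γ [] = 1) {k : ℕ}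
    (M : E [×k]→L[ℂ] F) (φ : E → E) (q : A →₀ ℕ) (x : E) :
    ∑ r ∈ (Finset.piAntidiag (Finset.univ : Finset (Fin k)) q).filter (fun r => ∀ i, r i ≠ 0),
        M (fun i => opSeries f γ φ (r i) x) =
      ∑ r ∈ Finset.piAntidiag Finset.univ q,
        M fun i => opSeries f γ (fun y => φ y - φ x) (r i) x := by
  rw [Finset.sum_filter]
  refine Finset.sum_congr rfl fun r _ => ?_
  split_ifs with hr
  · simp only [opSeries_sub_const f γ φ (φ x) (hr _)]
  · obtain ⟨i, hi⟩ := not_forall_not.1 hr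
    rw [M.map_coord_zero i (by rw [hi, opSeries_zero f hγ, sub_self])]

theorem substCoeff_opSeries (hf : ∀ ℓ, ContDiff ℂ ∞ (f ℓ)) {γ : List A → ℂ}
    (hγ : γ ∈ shuffleGroup A) {h φ : E → E} (hh : ContDiff ℂ ∞ h) (hφ : ContDiff ℂ ∞ φ)
    (q : A →₀ ℕ) (x : E) :
    FormalMap.substCoeff h (opSeries f γ φ) q x = opSeries f γ (fun y => h (φ y)) q x := by
  have hsub : ContDiff ℂ ∞ fun y => φ y - φ x := hφ.sub contDiff_const
  have hterm (k : ℕ) : ContDiff ℂ ∞ fun y => iteratedFDeriv ℂ k h (φ x) fun _ => φ y - φ x :=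
    (iteratedFDeriv ℂ k h (φ x)).contDiff.comp (contDiff_pi.2 fun _ => hsub)
  have htaylor : (fun y => h (φ y)) = fun y => (∑ k ∈ Finset.range (q.degree + 1),
      (k.factorial : ℂ)⁻¹ • iteratedFDeriv ℂ k h (φ x) fun _ => φ y - φ x) +
        taylorRemainder h (φ x) q.degree (φ y) :=
    funext fun y => (add_sub_cancel _ _).symm
  have hremainder : ContDiff ℂ ∞ fun y => taylorRemainder h (φ x) q.degree (φ y) :=
    (contDiff_taylorRemainder hh _ _).comp hφ
  rw [htaylor, opSeries_add hf γ (ContDiff.sum fun k _ => (hterm k).const_smul _) hremainder,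
    opSeries_sum hf γ _ _ hterm,
    opSeries_taylorRemainder_comp hf γ hh hφ, add_zero]
  simp only [FormalMap.substCoeff, opSeries_zero f hγ.1, opSeries_multilinear hf hγ hsub,
    sum_filter_ne_zero_opSeries f hγ.1]

end Multilinear

section VariationalEquation

variable {E F : Type*} [NormedAddCommGroup E] [NormedSpace ℝ E] [NormedAddCommGroup F]
  [NormedSpace ℝ F]

theorem exists_forall_norm_sub_sub_fderiv_le {G : E → F} (hG : ContDiff ℝ 1 G) {S : Set E}
    (hS : IsCompact S) {ε : ℝ} (hε : 0 < ε) : ∃ ρ > 0, ∀ p ∈ S, ∀ z, ‖z - p‖ ≤ ρ →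
      ‖G z - G p - fderiv ℝ G p (z - p)‖ ≤ ε * ‖z - p‖ := by
  have hunif := hS.uniformContinuousAt_of_continuousAt (fderiv ℝ G)
    (fun _ _ => (hG.continuous_fderiv one_ne_zero).continuousAt) (Metric.dist_mem_uniformity hε)
  obtain ⟨ρ, hρ, hclose⟩ := Metric.mem_uniformity_dist.1 hunif
  refine ⟨ρ / 2, half_pos hρ, fun p hp z hz => ?_⟩
  refine (convex_ball p ρ).norm_image_sub_le_of_norm_hasFDerivWithin_le'
    (fun y _ => (hG.differentiable one_ne_zero y).hasFDerivAt.hasFDerivWithinAt)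
    (fun y hy => ?_) (Metric.mem_ball_self hρ) (mem_ball_iff_norm.2 (by linarith))
  rw [← dist_eq_norm, dist_comm]
  exact (hclose (Metric.mem_ball'.1 hy) hp).le

theorem norm_le_mul_exp_of_norm_deriv_lt {r r' : ℝ → E} {K ε ρ : ℝ} (hK : 0 ≤ K) (hε : 0 ≤ ε)
    (hr : ∀ t ∈ Set.Icc (0 : ℝ) 1, HasDerivAt r (r' t) t) (hr0 : r 0 = 0)
    (hρ : ε * Real.exp (K + 1) ≤ ρ)
    (hr' : ∀ t ∈ Set.Icc (0 : ℝ) 1, ‖r t‖ ≤ ρ → ‖r' t‖ < K * ‖r t‖ + ε) :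
    ‖r 1‖ ≤ ε * Real.exp (K + 1) := by
  have hB (t : ℝ) : HasDerivAt (fun t => ε * Real.exp ((K + 1) * t))
      ((K + 1) * (ε * Real.exp ((K + 1) * t))) t :=
    ((((hasDerivAt_id t).const_mul (K + 1)).exp).const_mul ε).congr_deriv (by simp; ring)
  have hfence := image_norm_le_of_norm_deriv_right_lt_deriv_boundary (a := 0) (b := 1)
    (fun t ht => (hr t ht).continuousAt.continuousWithinAt)
    (fun t ht => (hr t (Set.Ico_subset_Icc_self ht)).hasDerivWithinAt)
    (by simpa [hr0] using hε) hB fun t ht hrB => ?_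
  · simpa using hfence (Set.right_mem_Icc.2 zero_le_one)
  have hBρ : ε * Real.exp ((K + 1) * t) ≤ ρ := by
    refine le_trans ?_ hρ
    gcongr
    exact mul_le_of_le_one_right (by linarith) ht.2.le
  have hεB : ε ≤ ε * Real.exp ((K + 1) * t) :=
    le_mul_of_one_le_right hε (Real.one_le_exp (mul_nonneg (by linarith) ht.1))
  have := hr' t (Set.Ico_subset_Icc_self ht) (hrB.trans_le hBρ)
  rw [hrB] at this
  linarith

theorem norm_sub_sub_smul_le_of_variational {G : E → E} {p m z : ℝ → E} {K M η ρ s : ℝ}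
    (hp : ∀ t, HasDerivAt p (G (p t)) t) (hz : ∀ t, HasDerivAt z (G (z t)) t)
    (hm : ∀ t, HasDerivAt m (fderiv ℝ G (p t) (m t)) t) (hz0 : z 0 = p 0 + s • m 0)
    (hK : ∀ t ∈ Set.Icc (0 : ℝ) 1, ‖fderiv ℝ G (p t)‖ ≤ K)
    (hM : ∀ t ∈ Set.Icc (0 : ℝ) 1, ‖m t‖ < M) (hη : 0 < η)
    (hG : ∀ t ∈ Set.Icc (0 : ℝ) 1, ∀ y, ‖y - p t‖ ≤ ρ →
      ‖G y - G (p t) - fderiv ℝ G (p t) (y - p t)‖ ≤ η * ‖y - p t‖)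
    (hs : s ≠ 0) (hρ : η * (|s| * M) * Real.exp (K + η + 1) + |s| * M ≤ ρ) :
    ‖z 1 - p 1 - s • m 1‖ ≤ η * (|s| * M) * Real.exp (K + η + 1) := by
  have h0 : (0 : ℝ) ∈ Set.Icc (0 : ℝ) 1 := Set.left_mem_Icc.2 zero_le_one
  have hK0 : 0 ≤ K := (norm_nonneg _).trans (hK 0 h0)
  have hM0 : 0 ≤ M := (norm_nonneg _).trans (hM 0 h0).le
  refine norm_le_mul_exp_of_norm_deriv_lt (r := fun t => z t - p t - s • m t)
    (ρ := ρ - |s| * M) (by positivity) (by positivity)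
    (fun t _ => ((hz t).sub (hp t)).sub ((hm t).const_smul s)) (by simp [hz0]) (by linarith)
    fun t ht hr => ?_
  set D := fderiv ℝ G (p t)
  have hsm : ‖s • m t‖ < |s| * M := by
    rw [norm_smul, Real.norm_eq_abs]
    exact mul_lt_mul_of_pos_left (hM t ht) (abs_pos.2 hs)
  have hzp : ‖z t - p t‖ ≤ ‖z t - p t - s • m t‖ + ‖s • m t‖ := norm_le_norm_sub_add _ _
  have hsplit : G (z t) - G (p t) - s • D (m t) =
      (G (z t) - G (p t) - D (z t - p t)) + D (z t - p t - s • m t) := by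
    simp only [map_sub, map_smul]
    abel
  calc ‖G (z t) - G (p t) - s • D (m t)‖
      ≤ η * ‖z t - p t‖ + K * ‖z t - p t - s • m t‖ := by
        rw [hsplit]
        exact (norm_add_le _ _).trans (add_le_add (hG t ht _ (by linarith))
          (D.le_of_opNorm_le (hK t ht) _))
    _ < (K + η) * ‖z t - p t - s • m t‖ + η * (|s| * M) := by nlinarith

theorem hasLineDerivAt_flow {G : E → E} (hG : ContDiff ℝ 1 G) {Φ : ℝ → E → E}
    (hΦ : ∀ t x, HasDerivAt (fun t => Φ t x) (G (Φ t x)) t) (hΦ0 : ∀ x, Φ 0 x = x) {x : E}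
    {m : ℝ → E} (hm : ∀ t, HasDerivAt m (fderiv ℝ G (Φ t x) (m t)) t) :
    HasLineDerivAt ℝ (Φ 1) (m 1) x (m 0) := by
  have hΦx : Continuous fun t => Φ t x :=
    continuous_iff_continuousAt.2 fun t => (hΦ t x).continuousAt
  obtain ⟨K, hK⟩ := (isCompact_Icc (a := (0 : ℝ)) (b := 1)).exists_bound_of_continuousOn
    ((hG.continuous_fderiv one_ne_zero).comp hΦx).continuousOn
  obtain ⟨M, hM⟩ := (isCompact_Icc (a := (0 : ℝ)) (b := 1)).exists_bound_of_continuousOn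
    fun t _ => (hm t).continuousAt.continuousWithinAt
  have hlim (C : ℝ) : Filter.Tendsto (fun s : ℝ => C * |s|) (nhds 0) (nhds 0) :=
    (continuous_const.mul continuous_abs).tendsto' _ _ (by simp)
  have : 0 < M + 1 := by linarith [(norm_nonneg _).trans (hM 0 (by simp))]
  rw [HasLineDerivAt, hasDerivAt_iff_isLittleO]
  refine Asymptotics.isLittleO_iff.2 fun c hc => ?_
  obtain ⟨η, hη0, hη⟩ : ∃ η > 0, η * (M + 1) * Real.exp (K + η + 1) ≤ c := by
    have htendsto : Filter.Tendsto (fun η => η * (M + 1) * Real.exp (K + η + 1)) (nhds 0)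
        (nhds 0) := Continuous.tendsto' (by fun_prop) _ _ (by simp)
    have hpos : ∀ᶠ η in nhdsWithin (0 : ℝ) (Set.Ioi 0), 0 < η := self_mem_nhdsWithin
    exact (hpos.and ((htendsto.eventually_le_const hc).filter_mono nhdsWithin_le_nhds)).exists
  obtain ⟨ρ, hρ, hGρ⟩ := exists_forall_norm_sub_sub_fderiv_le hG (isCompact_Icc.image hΦx) hη0
  filter_upwards [(hlim (c + (M + 1))).eventually_lt_const hρ] with s hs
  rcases eq_or_ne s 0 with rfl | hs0
  · simp
  have hcs : η * (|s| * (M + 1)) * Real.exp (K + η + 1) ≤ c * |s| := by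
    calc _ = η * (M + 1) * Real.exp (K + η + 1) * |s| := by ring
      _ ≤ c * |s| := by gcongr
  have := norm_sub_sub_smul_le_of_variational (p := fun t => Φ t x) (hΦ · x)
    (hΦ · (x + s • m 0)) hm (by simp [hΦ0]) hK (fun t ht => (hM t ht).trans_lt (lt_add_one M))
    hη0 (fun t ht => hGρ _ (Set.mem_image_of_mem _ ht)) hs0 (by linarith)
  simpa using this.trans hcs

end VariationalEquation

section Flow

variable {A E F : Type*} [NormedAddCommGroup E] [NormedSpace ℂ E] [NormedAddCommGroup F]
  [NormedSpace ℂ F] {d : ℕ} {ν : Fin d → A → ℂ} {g : Fin d → E → E} {f : A → E → E}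
  {φ : (Fin d → ℂ) → E → E}

theorem contDiff_linComb {n : ℕ∞} (hg : ∀ j, ContDiff ℂ n (g j)) (v : Fin d → ℂ) :
    ContDiff ℂ n (linComb g v) :=
  ContDiff.sum fun j _ => (hg j).const_smul (v j)

theorem lieBracket_linComb (hg : ∀ j, Differentiable ℂ (g j))
    (heigen : ∀ j ℓ, VectorField.lieBracket ℂ (g j) (f ℓ) = ν j ℓ • f ℓ) (v : Fin d → ℂ) (ℓ : A) :
    VectorField.lieBracket ℂ (linComb g v) (f ℓ) = nuWord ν v [ℓ] • f ℓ := by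
  funext x
  have hderiv : HasFDerivAt (linComb g v) (∑ j, v j • fderiv ℂ (g j) x) x :=
    HasFDerivAt.fun_sum fun j _ => (hg j x).hasFDerivAt.const_smul (v j)
  have hbracket (j : Fin d) : fderiv ℂ (f ℓ) x (g j x) - fderiv ℂ (g j) x (f ℓ x) =
      ν j ℓ • f ℓ x := congrFun (heigen j ℓ) x
  rw [VectorField.lieBracket, hderiv.fderiv]
  simp only [linComb, map_sum, map_smul, sum_apply, smul_apply, ← Finset.sum_sub_distrib,
    ← smul_sub, hbracket]
  simp [nuWord, Finset.sum_smul, mul_smul]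

theorem hasDerivAt_exp_smul_flow (hf : ∀ ℓ, Differentiable ℂ (f ℓ))
    (hφ : IsFlowFamily g φ) {v : Fin d → ℂ} {ℓ : A} {μ : ℂ}
    (hμ : VectorField.lieBracket ℂ (linComb g v) (f ℓ) = μ • f ℓ) (x : E) (t : ℝ) :
    HasDerivAt (fun t : ℝ => Complex.exp (-(t * μ)) • f ℓ (φ ((t : ℂ) • v) x))
      (fderiv ℂ (linComb g v) (φ ((t : ℂ) • v) x)
        (Complex.exp (-(t * μ)) • f ℓ (φ ((t : ℂ) • v) x))) t := by
  have hexp : HasDerivAt (fun t : ℝ => Complex.exp (-(t * μ))) (Complex.exp (-(t * μ)) * -μ) t :=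
    (by simpa using ((hasDerivAt_id (t : ℂ)).mul_const μ).fun_neg :
      HasDerivAt (fun z : ℂ => -(z * μ)) (-μ) (t : ℂ)).cexp.comp_ofReal
  have hfield : HasDerivAt (fun t : ℝ => f ℓ (φ ((t : ℂ) • v) x))
      (fderiv ℂ (f ℓ) (φ ((t : ℂ) • v) x) (linComb g v (φ ((t : ℂ) • v) x))) t :=
    ((hf ℓ _).hasFDerivAt.restrictScalars ℝ).comp_hasDerivAt t (hφ.integralCurve v x t)
  refine (hexp.fun_smul hfield).congr_deriv ?_
  have hbracket := congrFun hμ (φ ((t : ℂ) • v) x)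
  rw [VectorField.lieBracket, sub_eq_iff_eq_add] at hbracket
  rw [hbracket, map_smul, Pi.smul_apply, smul_add, smul_smul, mul_neg, neg_smul]
  abel

theorem apply_flow (hg : ∀ j, ContDiff ℂ 1 (g j)) (hf : ∀ ℓ, Differentiable ℂ (f ℓ))
    (heigen : ∀ j ℓ, VectorField.lieBracket ℂ (g j) (f ℓ) = ν j ℓ • f ℓ)
    (hφ : IsFlowFamily g φ) (v : Fin d → ℂ) (ℓ : A) (x : E) :
    f ℓ (φ v x) = Complex.exp (nuWord ν v [ℓ]) • fderiv ℂ (φ v) x (f ℓ x) := by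
  set μ := nuWord ν v [ℓ]
  have hG : ContDiff ℂ 1 (linComb g v) := contDiff_linComb hg v
  have hbracket := lieBracket_linComb (fun j => (hg j).differentiable one_ne_zero) heigen v ℓ
  have hflow := hasLineDerivAt_flow (hG.restrict_scalars ℝ)
    (Φ := fun t => φ ((t : ℂ) • v)) (x := x)
    (m := fun t : ℝ => Complex.exp (-(t * μ)) • f ℓ (φ ((t : ℂ) • v) x))
    (fun t x => hφ.integralCurve v x t) (fun x => by simpa using hφ.map_zero x) fun t => by
      rw [(hG.differentiable one_ne_zero _).fderiv_restrictScalars ℝ]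
      exact hasDerivAt_exp_smul_flow hf hφ hbracket x t
  have hderiv := (((hφ.smooth v).differentiable (by simp) x).hasFDerivAt.restrictScalars
    ℝ).hasLineDerivAt (f ℓ x)
  simp only [Complex.ofReal_zero, zero_mul, neg_zero, Complex.exp_zero, one_smul, zero_smul,
    Complex.ofReal_one, one_mul, hφ.map_zero] at hflow
  rw [ContinuousLinearMap.coe_restrictScalars'] at hderiv
  rw [hderiv.unique hflow, smul_smul, ← Complex.exp_add, add_neg_cancel, Complex.exp_zero,
    one_smul]

theorem wordOp_apply_flow (hg : ∀ j, ContDiff ℂ 1 (g j)) (hf : ∀ ℓ, ContDiff ℂ ∞ (f ℓ))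
    (heigen : ∀ j ℓ, VectorField.lieBracket ℂ (g j) (f ℓ) = ν j ℓ • f ℓ)
    (hφ : IsFlowFamily g φ) (v : Fin d → ℂ) {h : E → F} (hh : ContDiff ℂ ∞ h) (w : List A)
    (x : E) :
    wordOp f w h (φ v x) = Complex.exp (nuWord ν v w) • wordOp f w (fun y => h (φ v y)) x := by
  induction w generalizing x with
  | nil => simp [wordOp]
  | cons ℓ w ih =>
    have hleft := (differentiable_wordOp hf w hh (φ v x)).hasFDerivAt.comp x
      ((hφ.smooth v).differentiable (by simp) x).hasFDerivAt
    have hright := (differentiable_wordOp hf w (hh.comp (hφ.smooth v)) x).hasFDerivAt.const_smul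
      (Complex.exp (nuWord ν v w))
    have hchain := DFunLike.congr_fun
      (hleft.unique (hright.congr_of_eventuallyEq (Filter.Eventually.of_forall ih))) (f ℓ x)
    simp only [wordOp]
    rw [apply_flow hg (fun ℓ => (hf ℓ).differentiable (by simp)) heigen hφ v ℓ x, map_smul,
      ← List.singleton_append (l := w), nuWord_append, Complex.exp_add, mul_smul]
    exact congrArg _ hchain

end Flow

section Composition

variable {A : Type*} [DecidableEq A] {E : Type*} [NormedAddCommGroup E] [NormedSpace ℂ E]

theorem sum_wordsOf_conv {M : Type*} [AddCommMonoid M] [Module ℂ M] (γ δ : List A → ℂ)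
    (m : A →₀ ℕ) (X : List A → M) :
    ∑ p ∈ Finset.HasAntidiagonal.antidiagonal m, ∑ u ∈ wordsOf p.1, ∑ w ∈ wordsOf p.2,
      (γ u * δ w) • X (u ++ w) = ∑ s ∈ wordsOf m, conv γ δ s • X s := by
  simp only [conv, Finset.sum_smul]
  rw [← sum_wordPairsOf m fun p => (γ p.1 * δ p.2) • X (p.1 ++ p.2), Finset.sum_sigma']
  refine Finset.sum_bij' (fun p _ => ⟨p.1 ++ p.2, p.1.length⟩)
    (fun s _ => (s.1.take s.2, s.1.drop s.2)) ?_ ?_ ?_ ?_ ?_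
  · intro p hp
    simpa [mem_wordPairsOf] using hp
  · rintro ⟨s, j⟩ hs
    rw [Finset.mem_sigma] at hs
    simpa [mem_wordPairsOf] using hs.1
  · simp
  · rintro ⟨s, j⟩ hs
    rw [Finset.mem_sigma, Finset.mem_range, Nat.lt_succ_iff] at hs
    simp [hs.2]
  · simp

variable {F : Type*} [NormedAddCommGroup F] [NormedSpace ℂ F] {f : A → E → E}

theorem sum_opSeries_opSeries (hf : ∀ ℓ, ContDiff ℂ ∞ (f ℓ)) (γ δ : List A → ℂ) {ψ : E → F}
    (hψ : ContDiff ℂ ∞ ψ) (m : A →₀ ℕ) (x : E) :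
    ∑ p ∈ Finset.HasAntidiagonal.antidiagonal m, opSeries f γ (opSeries f δ ψ p.1) p.2 x =
      opSeries f (conv γ δ) ψ m x := by
  have hinner (q : A →₀ ℕ) (u : List A) :
      wordOp f u (opSeries f δ ψ q) x = ∑ w ∈ wordsOf q, δ w • wordOp f (u ++ w) ψ x := by
    simp only [wordOp_append]
    exact wordOp_sum hf u _ δ (fun w => contDiff_wordOp hf w hψ) x
  rw [opSeries, ← sum_wordsOf_conv, ← Finset.HasAntidiagonal.map_swap_antidiagonal,
    Finset.sum_map]
  simp [opSeries, hinner, Finset.smul_sum, smul_smul]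

theorem opSeries_convOne (f : A → E → E) (φ : E → E) :
    opSeries f convOne φ = FormalMap.const φ := by
  funext m x
  by_cases hm : m = 0
  · simp [FormalMap.const, hm, opSeries_zero f (γ := convOne) rfl]
  · rw [FormalMap.const, if_neg hm]
    refine Finset.sum_eq_zero fun w hw => ?_
    cases w with
    | nil => exact absurd (by simpa using (mem_wordsOf.1 hw).symm) hm
    | cons a w => rw [convOne, zero_smul]

theorem const_comp (h : E → E) (Ψ : FormalMap A E) :
    FormalMap.comp (FormalMap.const h) Ψ = FormalMap.substCoeff h Ψ := by
  have hconst {p : A →₀ ℕ} (hp : p ≠ 0) : FormalMap.const (A := A) h p = 0 :=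
    funext fun y => if_neg hp
  funext m x
  rw [FormalMap.comp, Finset.sum_eq_single (0, m)]
  · rfl
  · rintro ⟨p, q⟩ hpq hne
    have hp : p ≠ 0 := by
      rintro rfl
      exact hne (by simpa using hpq)
    simp [FormalMap.substCoeff, hconst hp]
  · simp

theorem extWordSeries_eq_opSeries {d : ℕ} (hf : ∀ ℓ, ContDiff ℂ ∞ (f ℓ))
    {φ : (Fin d → ℂ) → E → E} {v : Fin d → ℂ} (hφ : ContDiff ℂ ∞ (φ v)) {γ : List A → ℂ}
    (hγ : γ ∈ shuffleGroup A) : extWordSeries φ f (v, γ) = opSeries f γ (φ v) := by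
  rw [extWordSeries, wordSeries_eq_opSeries, const_comp]
  exact funext fun q => funext (substCoeff_opSeries hf hγ hφ contDiff_id q)

theorem opSeries_comp_wordSeries (hf : ∀ ℓ, ContDiff ℂ ∞ (f ℓ)) {ψ : E → E}
    (hψ : ContDiff ℂ ∞ ψ) {γ : List A → ℂ} (hγ : γ ∈ shuffleGroup A) (δ : List A → ℂ) :
    FormalMap.comp (opSeries f δ ψ) (wordSeries f γ) = opSeries f (conv γ δ) ψ := by
  funext m x
  rw [wordSeries_eq_opSeries, FormalMap.comp, ← sum_opSeries_opSeries hf γ δ hψ]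
  exact Finset.sum_congr rfl fun p _ =>
    substCoeff_opSeries hf hγ (contDiff_opSeries hf δ hψ p.1) contDiff_id p.2 x

theorem wordSeries_comp_eq_const_id (hf : ∀ ℓ, ContDiff ℂ ∞ (f ℓ)) {γ δ : List A → ℂ}
    (hγ : γ ∈ shuffleGroup A) (h : conv γ δ = convOne) :
    FormalMap.comp (wordSeries f δ) (wordSeries f γ) = FormalMap.const id := by
  rw [wordSeries_eq_opSeries f δ, opSeries_comp_wordSeries hf contDiff_id hγ, h, opSeries_convOne]

variable {d : ℕ} {ν : Fin d → A → ℂ} {g : Fin d → E → E} {φ : (Fin d → ℂ) → E → E}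

theorem wordSeries_comp_opSeries_flow (hg : ∀ j, ContDiff ℂ 1 (g j))
    (hf : ∀ ℓ, ContDiff ℂ ∞ (f ℓ))
    (heigen : ∀ j ℓ, VectorField.lieBracket ℂ (g j) (f ℓ) = ν j ℓ • f ℓ)
    (hφ : IsFlowFamily g φ) (v : Fin d → ℂ) {γ : List A → ℂ} (hγ : γ ∈ shuffleGroup A)
    (δ : List A → ℂ) :
    FormalMap.comp (wordSeries f δ) (opSeries f γ (φ v)) =
      opSeries f (conv γ (Xi ν v δ)) (φ v) := by
  have hflow (m : A →₀ ℕ) (y : E) :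
      opSeries f δ id m (φ v y) = opSeries f (Xi ν v δ) (φ v) m y := by
    refine Finset.sum_congr rfl fun w _ => ?_
    rw [wordOp_apply_flow hg hf heigen hφ v contDiff_id w y, smul_smul, Xi, mul_comm]
    rfl
  funext m x
  rw [wordSeries_eq_opSeries, FormalMap.comp,
    ← sum_opSeries_opSeries hf γ (Xi ν v δ) (hφ.smooth v)]
  refine Finset.sum_congr rfl fun p _ => ?_
  rw [substCoeff_opSeries hf hγ (contDiff_opSeries hf δ contDiff_id p.1) (hφ.smooth v),
    funext (hflow p.1)]

theorem flow_comp_wordSeries_comm (hg : ∀ j, ContDiff ℂ 1 (g j))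
    (hf : ∀ ℓ, ContDiff ℂ ∞ (f ℓ))
    (heigen : ∀ j ℓ, VectorField.lieBracket ℂ (g j) (f ℓ) = ν j ℓ • f ℓ)
    (hφ : IsFlowFamily g φ) {u : Fin d → ℂ} {γ : List A → ℂ} (hγ : γ ∈ shuffleGroup A)
    (hu : Xi ν u γ = γ) :
    FormalMap.comp (FormalMap.const (φ u)) (wordSeries f γ) =
      FormalMap.comp (wordSeries f γ) (FormalMap.const (φ u)) := by
  rw [← opSeries_convOne f (φ u), wordSeries_comp_opSeries_flow hg hf heigen hφ u
    convOne_mem_shuffleGroup, convOne_conv, hu, opSeries_convOne]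
  exact extWordSeries_eq_opSeries hf (hφ.smooth u) hγ

theorem extWordSeries_comp_wordSeries (hg : ∀ j, ContDiff ℂ 1 (g j))
    (hf : ∀ ℓ, ContDiff ℂ ∞ (f ℓ))
    (heigen : ∀ j ℓ, VectorField.lieBracket ℂ (g j) (f ℓ) = ν j ℓ • f ℓ)
    (hφ : IsFlowFamily g φ) {v : Fin d → ℂ} {κ η η' : List A → ℂ} (hκ : κ ∈ shuffleGroup A)
    (hη : η ∈ shuffleGroup A) (hη' : η' ∈ shuffleGroup A)
    (hconj : conv η' (Xi ν v κ) = conv κ η) :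
    FormalMap.comp (extWordSeries φ f (v, η)) (wordSeries f κ) =
      FormalMap.comp (wordSeries f κ) (extWordSeries φ f (v, η')) := by
  rw [extWordSeries_eq_opSeries hf (hφ.smooth v) hη, extWordSeries_eq_opSeries hf (hφ.smooth v) hη',
    opSeries_comp_wordSeries hf (hφ.smooth v) hκ,
    wordSeries_comp_opSeries_flow hg hf heigen hφ v hη', hconj]

end Composition

universe u

theorem theorem4_general {A : Type*} [DecidableEq A] {d : ℕ} (ν : Fin d → A → ℂ)
    (v : Fin d → ℂ) {η : List A → ℂ} (hη : η ∈ shuffleGroup A) :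
    ∃ κ ∈ shuffleGroup A, ∃ κinv ∈ shuffleGroup A, ∃ ηhat ∈ shuffleGroup A,
      conv κ κinv = convOne ∧ conv κinv κ = convOne ∧
      ηhat = conv (conv κ η) (Xi ν v κinv) ∧
      (v, ηhat) = extMul ν (extMul ν (0, κ) (v, η)) (0, κinv) ∧
      Xi ν v ηhat = ηhat ∧
      ∀ (E : Type u) [NormedAddCommGroup E] [NormedSpace ℂ E] (g : Fin d → E → E) (f : A → E → E)
        (φ : (Fin d → ℂ) → E → E), (∀ j, ContDiff ℂ 1 (g j)) → (∀ ℓ, ContDiff ℂ ∞ (f ℓ)) →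
        (∀ j ℓ, VectorField.lieBracket ℂ (g j) (f ℓ) = ν j ℓ • f ℓ) → IsFlowFamily g φ →
          (FormalMap.comp (wordSeries f κ) (wordSeries f κinv) = FormalMap.const id ∧
            FormalMap.comp (wordSeries f κinv) (wordSeries f κ) = FormalMap.const id ∧
            FormalMap.comp (extWordSeries φ f (v, η)) (wordSeries f κ) =
              FormalMap.comp (wordSeries f κ) (extWordSeries φ f (v, ηhat))) ∧
          (extWordSeries φ f (v, ηhat) =
              FormalMap.comp (FormalMap.const (φ v)) (wordSeries f ηhat) ∧
            FormalMap.comp (FormalMap.const (φ v)) (wordSeries f ηhat) =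
              FormalMap.comp (wordSeries f ηhat) (FormalMap.const (φ v))) ∧
          ∀ u : Fin d → ℂ,
            (∀ w : List A, Complex.exp (nuWord ν v w) = 1 → Complex.exp (nuWord ν u w) = 1) →
            FormalMap.comp (FormalMap.const (φ u)) (wordSeries f ηhat) =
              FormalMap.comp (wordSeries f ηhat) (FormalMap.const (φ u)) := by
  obtain ⟨κ, hκ, ηhat, hηhat, hconj, hres⟩ := exists_resonant_normalForm ν v hη
  obtain ⟨κinv, hκinv, hright, hleft⟩ := exists_mem_shuffleGroup_conv_eq_convOne hκ
  have hηhat_eq : ηhat = conv (conv κ η) (Xi ν v κinv) := by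
    rw [← hconj, conv_assoc, ← Xi_conv, hright, Xi_convOne, conv_convOne]
  have hfix : Xi ν v ηhat = ηhat := Xi_eq_self hres
  refine ⟨κ, hκ, κinv, hκinv, ηhat, hηhat, hright, hleft, hηhat_eq, ?_, hfix,
    fun E _ _ g f φ hg hf heigen hφ => ⟨⟨wordSeries_comp_eq_const_id hf hκinv hleft,
      wordSeries_comp_eq_const_id hf hκ hright,
      extWordSeries_comp_wordSeries hg hf heigen hφ hκ hη hηhat hconj⟩,
      ⟨rfl, flow_comp_wordSeries_comm hg hf heigen hφ hηhat hfix⟩, fun u hu =>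
        flow_comp_wordSeries_comm hg hf heigen hφ hηhat <|
          Xi_eq_self fun w hw => hres w (mt (hu w) hw)⟩⟩
  simp [extMul, Xi_zero, hηhat_eq, hκinv.1]

end

theorem theorem4 {A : Type*} [Countable A] [DecidableEq A] {d : ℕ} (ν : Fin d → A → ℂ)
    (v : Fin d → ℂ) (η : List A → ℂ) (hη : η ∈ shuffleGroup A) :
    ∃ κ ∈ shuffleGroup A, ∃ κinv ∈ shuffleGroup A, ∃ ηhat ∈ shuffleGroup A,
      conv κ κinv = convOne ∧ conv κinv κ = convOne ∧
      ηhat = conv (conv κ η) (Xi ν v κinv) ∧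
      (v, ηhat) = extMul ν (extMul ν (0, κ) (v, η)) (0, κinv) ∧
      Xi ν v ηhat = ηhat ∧
      ∀ (D : ℕ) (g : Fin d → (Fin D → ℂ) → (Fin D → ℂ)) (f : A → (Fin D → ℂ) → (Fin D → ℂ))
        (φ : (Fin d → ℂ) → (Fin D → ℂ) → (Fin D → ℂ)),
        IsPerturbedSystem ν g f → IsFlowFamily g φ →
          (FormalMap.comp (wordSeries f κ) (wordSeries f κinv) = FormalMap.const id ∧
            FormalMap.comp (wordSeries f κinv) (wordSeries f κ) = FormalMap.const id ∧
            FormalMap.comp (extWordSeries φ f (v, η)) (wordSeries f κ) =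
              FormalMap.comp (wordSeries f κ) (extWordSeries φ f (v, ηhat))) ∧
          (extWordSeries φ f (v, ηhat) =
              FormalMap.comp (FormalMap.const (φ v)) (wordSeries f ηhat) ∧
            FormalMap.comp (FormalMap.const (φ v)) (wordSeries f ηhat) =
              FormalMap.comp (wordSeries f ηhat) (FormalMap.const (φ v))) ∧
          ∀ u : Fin d → ℂ,
            (∀ w : List A, Complex.exp (nuWord ν v w) = 1 → Complex.exp (nuWord ν u w) = 1) →
            FormalMap.comp (FormalMap.const (φ u)) (wordSeries f ηhat) =
              FormalMap.comp (wordSeries f ηhat) (FormalMap.const (φ u)) := by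
  obtain ⟨κ, hκ, κinv, hκinv, ηhat, hηhat, hright, hleft, heq, hext, hfix, hmain⟩ :=
    theorem4_general ν v hη
  exact ⟨κ, hκ, κinv, hκinv, ηhat, hηhat, hright, hleft, heq, hext, hfix, fun D g f φ hs hφ =>
    hmain (Fin D → ℂ) g f φ (fun j => (hs.smooth_g j).of_le (by simp)) hs.smooth_f hs.eigen hφ⟩
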